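/- Let $S^n=\mathbb{R}^n\cup\{\infty\}$ be the conformal $n$-sphere, identified with the space of light lines in Lorentz space $\mathbb{R}^{n+1,1}$, and let $Z=S^n\times S^n\setminus\Delta$ be the space of ordered pairs of distinct points of $S^n$. The group $G=\mathrm{O}^+(n+1,1)$ of linear isometries of $\mathbb{R}^{n+1,1}$ preserving the components of the light cone acts transitively on $Z$ by the diagonal Möbius action, and $Z=G/K$ is a symmetric space, $K$ being the stabiliser of $(0,\infty)$. Let $\mathfrak{p}\subset\mathfrak{g}=\mathfrak{o}(n+1,1)$ be the $(-1)$-eigenspace of conjugation by the linear involution that is $+1$ on the plane spanned by the light lines $0,\infty$ and $-1$ on its orthogonal complement. For $z=g\cdot(0,\infty)$, the map $\xi\mapsto\frac{d}{dt}\big|_{t=0}\exp(t\xi)\cdot z$ identifies $\mathrm{Ad}(g)\mathfrak{p}\subset\mathfrak{g}$ with $T_zZ$. A smooth immersion $\phi:M\to Z$ is a \emph{curved flat} if, under this identification, every $d\phi(T_pM)$ is an abelian subalgebra of $\mathfrak{g}$. Let $C\ell_n$ be the Clifford algebra of Euclidean $\mathbb{R}^n$, with $vw+wv=-2(v,w)$;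 for $C\ell_n$-valued $1$-forms put $(\alpha\wedge\beta)(X,Y)=\alpha(X)\beta(Y)-\alpha(Y)\beta(X)$. Smooth non-constant maps $f,\hat f$ into $\mathbb{R}^n$ whose values never coincide form a \emph{Darboux pair} if $df\wedge g^{-1}\,d\hat f\,g^{-1}=0$, where $g=\hat f-f$. An immersion $f$ of a surface into $\mathbb{R}^n$ is \emph{isothermic} if there is a smooth non-constant $\mathbb{R}^n$-valued map $f^c$ with $df\wedge df^c=0$, and \emph{locally isothermic} if every point has a connected open neighbourhood on which it is isothermic. A map $(f,\hat f):M\to Z$ is a \emph{Darboux pair of isothermic surfaces} if $\dim M=2$ and, for every $v\in S^n$, stereographic projection from $v$ turns the restriction of $(f,\hat f)$ to the open set $\{p\in M: f(p)\neq v\neq\hat f(p)\}$ into a Darboux pair of maps into $\mathbb{R}^n$, both of which are locally isothermic. Theorem. Let $M$ be a non-empty smooth manifold with $\dim M\geq 2$ and let $(f,\hat f):M\to Z=S^n\times S^n\setminus\Delta$ be non-degenerate, i.e. both $f$ and $\hat f$ are smooth immersions $M\to S^n$. Then $(f,\hat f)$ is a curved flat if and only if $(f,\hat f)$ is a Darboux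 pair of isothermic surfaces. (In particular a non-degenerate curved flat of dimension at least $2$ is a surface.) -/

import Mathlib

open scoped Manifold ContDiff EuclideanSpace

noncomputable section

namespace PointPairs

attribute [local instance 100] LieRing.ofAssociativeRing

/-! ### The conformal sphere, Lorentz space and the Möbius group -/

/-- Euclidean space `ℝⁿ`. -/
abbrev E (n : ℕ) : Type := EuclideanSpace ℝ (Fin n)

/-- The sphere `Sⁿ`, as the unit sphere of `ℝⁿ⁺¹`. -/
abbrev S (n : ℕ) : Type := Metric.sphere (0 : E (n + 1)) 1

/-- Lorentz space `ℝⁿ⁺¹ ⊕ ℝ`, of signature `(n + 1, 1)`; the second factor is the time axis. -/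
abbrev Lor (n : ℕ) : Type := E (n + 1) × ℝ

variable {n : ℕ}

/-- The Lorentz inner product, of signature `(n + 1, 1)`. -/
def lor (u v : Lor n) : ℝ := inner ℝ u.1 v.1 - u.2 * v.2

/-- The component `𝓛⁺` of the light cone that contains the vectors with positive time
coordinate. -/
def futureCone (n : ℕ) : Set (Lor n) := {v | lor v v = 0 ∧ 0 < v.2}

/-- The group `O⁺(n + 1, 1)`: linear isometries of Lorentz space that preserve the components of
the light cone. -/
def OPlus (n : ℕ) : Subgroup (Lor n ≃L[ℝ] Lor n) where
  carrier := {g | (∀ u v, lor (g u) (g v) = lor u v) ∧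
    ∀ v, g v ∈ futureCone n ↔ v ∈ futureCone n}
  mul_mem' := by
    rintro a b ⟨ha, ha'⟩ ⟨hb, hb'⟩
    exact ⟨fun u v => (ha _ _).trans (hb u v), fun v => (ha' _).trans (hb' v)⟩
  one_mem' := ⟨fun _ _ => rfl, fun _ => Iff.rfl⟩
  inv_mem' := by
    rintro a ⟨ha, ha'⟩
    refine ⟨fun u v => ?_, fun v => ?_⟩
    · have h := ha (a.symm u) (a.symm v)
      simp only [ContinuousLinearEquiv.apply_symm_apply] at h
      exact h.symm
    · have h := ha' (a.symm v)
      simp only [ContinuousLinearEquiv.apply_symm_apply] at h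
      exact h.symm

/-- The lift of a point of `Sⁿ` to the light cone: `x` corresponds to the light line spanned by
`(x, 1)`, which identifies `Sⁿ` with the projectivised light cone. -/
def lift (x : S n) : Lor n := ((x : E (n + 1)), 1)

/-- The projective action of a linear map of Lorentz space on `Sⁿ`: `x` goes to the point, written
in `ℝⁿ⁺¹`, at which the line spanned by `T (x, 1)` meets the hyperplane of time coordinate `1`. -/
def projAct (T : Lor n →L[ℝ] Lor n) (x : S n) : E (n + 1) := (T (lift x)).2⁻¹ • (T (lift x)).1

theorem lift_mem (x : S n) : lift x ∈ futureCone n := by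
  have hx : ‖(x : E (n + 1))‖ = 1 := by simp
  refine ⟨?_, one_pos⟩
  simp [lor, lift, hx]

theorem projAct_mem (g : OPlus n) (x : S n) :
    projAct (g.1 : Lor n →L[ℝ] Lor n) x ∈ Metric.sphere (0 : E (n + 1)) 1 := by
  obtain ⟨h0, hpos⟩ := (g.2.2 (lift x)).2 (lift_mem x)
  simp only [lor, real_inner_self_eq_norm_sq] at h0
  have h1 : ‖(g.1 (lift x)).1‖ = (g.1 (lift x)).2 :=
    (pow_left_inj₀ (norm_nonneg _) hpos.le two_ne_zero).1 (by linarith)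
  rw [mem_sphere_zero_iff_norm]
  simp only [projAct, ContinuousLinearEquiv.coe_coe, norm_smul, norm_inv, Real.norm_eq_abs,
    abs_of_pos hpos, h1]
  exact inv_mul_cancel₀ hpos.ne'

theorem apply_lift (g : OPlus n) (x : S n) :
    g.1 (lift x) = (g.1 (lift x)).2 • lift (⟨_, projAct_mem g x⟩ : S n) := by
  have hpos := ((g.2.2 (lift x)).2 (lift_mem x)).2
  refine Prod.ext ?_ ?_
  · simp [lift, projAct, smul_smul, mul_inv_cancel₀ (show (g.1 ((x : E (n + 1)), (1 : ℝ))).2 ≠ 0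
      from hpos.ne')]
  · simp [lift]

/-- `O⁺(n + 1, 1)` acts on `Sⁿ`, as the Möbius group. -/
instance : MulAction (OPlus n) (S n) where
  smul g x := ⟨projAct (g.1 : Lor n →L[ℝ] Lor n) x, projAct_mem g x⟩
  one_smul x := Subtype.ext (by
    change (1 : ℝ)⁻¹ • (x : E (n + 1)) = x
    simp)
  mul_smul g h x := Subtype.ext (by
    have hpos := ((h.2.2 (lift x)).2 (lift_mem x)).2
    change (g.1 (h.1 (lift x))).2⁻¹ • (g.1 (h.1 (lift x))).1 =
      (g.1 (lift (⟨_, projAct_mem h x⟩ : S n))).2⁻¹ •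
        (g.1 (lift (⟨_, projAct_mem h x⟩ : S n))).1
    rw [apply_lift h x, map_smul, Prod.smul_fst, Prod.smul_snd, smul_smul, smul_eq_mul, mul_inv,
      mul_right_comm, inv_mul_cancel₀ hpos.ne', one_mul])

/-! ### The symmetric space of point pairs -/

/-- The space `Z = Sⁿ × Sⁿ ∖ Δ` of ordered pairs of distinct points of `Sⁿ`. -/
def Z (n : ℕ) : Type := {z : S n × S n // z.1 ≠ z.2}

/-- The diagonal action of `O⁺(n + 1, 1)` on `Z`. -/
instance : MulAction (OPlus n) (Z n) where
  smul g z := ⟨(g • z.1.1, g • z.1.2), fun h => z.2 (MulAction.injective g h)⟩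
  one_smul z := Subtype.ext (Prod.ext (one_smul _ z.1.1) (one_smul _ z.1.2))
  mul_smul g h z := Subtype.ext (Prod.ext (mul_smul g h z.1.1) (mul_smul g h z.1.2))

/-- The point `∞` of `Sⁿ = ℝⁿ ∪ {∞}`: the pole of stereographic projection. -/
def pole (n : ℕ) : S n := ⟨EuclideanSpace.single (Fin.last n) 1, by simp⟩

/-- The base point `(0, ∞)` of `Z`; the point `0` of `ℝⁿ` corresponds to the antipode of the
pole. -/
def basePoint (n : ℕ) : Z n := ⟨(-pole n, pole n), by
  intro h
  have h1 : (-(pole n : S n) : S n).1 = (pole n).1 := congrArg Subtype.val h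
  have h2 := congrArg (fun x : E (n + 1) => x (Fin.last n)) h1
  simp [pole] at h2
  linarith⟩

/-- The Lie algebra `𝔬(n + 1, 1)` of skew endomorphisms of Lorentz space. -/
def lieO (n : ℕ) : LieSubalgebra ℝ (Lor n →L[ℝ] Lor n) where
  carrier := {ξ | ∀ u v, lor (ξ u) v + lor u (ξ v) = 0}
  add_mem' := by
    intro a b ha hb u v
    have h1 := ha u v
    have h2 := hb u v
    simp only [lor, add_apply, Prod.fst_add, Prod.snd_add, inner_add_left,
      inner_add_right] at *
    linarith
  zero_mem' := by intro u v; simp [lor]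
  smul_mem' := by
    intro c a ha u v
    have h1 := ha u v
    simp only [lor, smul_apply, Prod.smul_fst, Prod.smul_snd,
      real_inner_smul_left, real_inner_smul_right, smul_eq_mul] at *
    linear_combination c * h1
  lie_mem' := by
    intro a b ha hb u v
    have h1 := ha (b u) v
    have h2 := hb (a u) v
    have h3 := ha u (b v)
    have h4 := hb u (a v)
    simp only [lor, Ring.lie_def, sub_apply, mul_apply_eq_comp,
      Prod.fst_sub, Prod.snd_sub, inner_sub_left, inner_sub_right] at *
    linarith

/-- The linear involution of Lorentz space that is `+1` on the `(1, 1)`-plane spanned by the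
light lines `0` and `∞` and `-1` on its orthogonal complement `ℝⁿ`. -/
def invol (n : ℕ) : Lor n →L[ℝ] Lor n :=
  ((2 : ℝ) • (innerSL ℝ (pole n : E (n + 1))).smulRight (pole n : E (n + 1)) -
    ContinuousLinearMap.id ℝ (E (n + 1))).prodMap (ContinuousLinearMap.id ℝ ℝ)

/-- The summand `𝔭` of the symmetric decomposition `𝔬(n + 1, 1) = 𝔨 ⊕ 𝔭` at the base point: the
`-1`-eigenspace of the involution `τ`, which is conjugation by `invol` (its own inverse). -/
def pSpace (n : ℕ) : Set (Lor n →L[ℝ] Lor n) :=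
  {ξ | ξ ∈ lieO n ∧ invol n ∘L ξ ∘L invol n = -ξ}

/-- The subspace `Ad(g) 𝔭` of `𝔬(n + 1, 1)` that is identified with the tangent space of
`Z = G/K` at `g • (0, ∞)`. -/
def adP (g : OPlus n) : Set (Lor n →L[ℝ] Lor n) :=
  {ξ | ∃ ζ ∈ pSpace n,
    ξ = (g.1 : Lor n →L[ℝ] Lor n) ∘L ζ ∘L ((g.1.symm : Lor n ≃L[ℝ] Lor n) : Lor n →L[ℝ] Lor n)}

/-- `ξ` induces the tangent vector `w` of `Sⁿ` at `x`, that is, `w = d/dt|₀ exp(tξ)·x`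
(tangent vectors of `Sⁿ` are read in `ℝⁿ⁺¹`). -/
def Induces (ξ : Lor n →L[ℝ] Lor n) (x : S n) (w : E (n + 1)) : Prop :=
  HasDerivAt (fun t : ℝ => projAct (NormedSpace.exp (t • ξ)) x) w 0

/-! ### Curved flats -/

section Maps

variable (m : ℕ) {M : Type*} [TopologicalSpace M] [ChartedSpace (E m) M]

/-- The first component `f` of a map `(f, f̂)` into `Z`. -/
def fst (φ : M → Z n) : M → S n := fun p => (φ p).1.1

/-- The second component `f̂` of a map `(f, f̂)` into `Z`. -/
def snd (φ : M → Z n) : M → S n := fun p => (φ p).1.2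

/-- The derivative at `p` of a map into `Sⁿ`, with values read in `ℝⁿ⁺¹`. -/
def dS (f : M → S n) (p : M) (X : TangentSpace (𝓡 m) p) : E (n + 1) :=
  mfderiv (𝓡 m) 𝓘(ℝ, E (n + 1)) (fun q => (f q : E (n + 1))) p X

/-- Smooth immersions into `Sⁿ`. -/
def IsImmersedS (f : M → S n) : Prop :=
  ContMDiff (𝓡 m) (𝓡 n) ∞ f ∧ ∀ p, Function.Injective (mfderiv (𝓡 m) (𝓡 n) f p)

/-- Smooth immersions into `Z`, an open subset of `Sⁿ × Sⁿ`. -/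
def IsImmersedZ (φ : M → Z n) : Prop :=
  ContMDiff (𝓡 m) ((𝓡 n).prod (𝓡 n)) ∞ (fun p => (φ p).1) ∧
    ∀ p, Function.Injective (mfderiv (𝓡 m) ((𝓡 n).prod (𝓡 n)) (fun q => (φ q).1) p)

/-- A map `(f, f̂)` into `Z` is non-degenerate if both components are immersions. -/
def NonDegenerate (φ : M → Z n) : Prop := IsImmersedS m (fst φ) ∧ IsImmersedS m (snd φ)

/-- The subspace `dφ(T_p M)` of `𝔬(n + 1, 1)`, through `T_{φ(p)} Z ≅ Ad(g) 𝔭` where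
`φ(p) = g • (0, ∞)`. -/
def tangentImage (φ : M → Z n) (p : M) : Set (Lor n →L[ℝ] Lor n) :=
  {ξ | (∃ g : OPlus n, g • basePoint n = φ p ∧ ξ ∈ adP g) ∧
    ∃ X : TangentSpace (𝓡 m) p,
      Induces ξ (fst φ p) (dS m (fst φ) p X) ∧ Induces ξ (snd φ p) (dS m (snd φ) p X)}

/-- Curved flats in `Z`: immersions all of whose tangent spaces are abelian in
`𝔬(n + 1, 1)`. -/
def IsCurvedFlat (φ : M → Z n) : Prop :=
  IsImmersedZ m φ ∧ ∀ p, ∀ ξ ∈ tangentImage m φ p, ∀ η ∈ tangentImage m φ p, ⁅ξ, η⁆ = 0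

/-! ### Isothermic surfaces and Darboux pairs in `ℝⁿ` -/

/-- The Clifford algebra `Cℓ_n` of `ℝⁿ`, with `v w + w v = -2 (v, w)`. -/
abbrev Cl (n : ℕ) : Type := CliffordAlgebra (-(LinearMap.BilinMap.toQuadraticMap (innerₗ (E n))))

/-- The inclusion `ℝⁿ ⊂ Cℓ_n`. -/
def cl (v : E n) : Cl n := CliffordAlgebra.ι _ v

/-- The value `(α ∧ β)(X, Y)` of the exterior product of two `Cℓ_n`-valued forms of degree `1`. -/
def wedge {T : Type*} (α β : T → Cl n) (X Y : T) : Cl n := α X * β Y - α Y * β X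

/-- The derivative at `p` of a map into `ℝⁿ`, as a `Cℓ_n`-valued form. -/
def dE (f : M → E n) (p : M) (X : TangentSpace (𝓡 m) p) : Cl n :=
  cl (mfderiv (𝓡 m) 𝓘(ℝ, E n) f p X)

/-- On an open set `U`, `(f, f̂)` is a Darboux pair of maps into `ℝⁿ`: the two maps are smooth,
not constant and nowhere equal, and `df ∧ g⁻¹ df̂ g⁻¹ = 0` where `g = f̂ - f`. -/
def IsDarbouxPairOn (U : Set M) (f fhat : M → E n) : Prop :=
  ContMDiffOn (𝓡 m) 𝓘(ℝ, E n) ∞ f U ∧ ContMDiffOn (𝓡 m) 𝓘(ℝ, E n) ∞ fhat U ∧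
  (∃ p ∈ U, ∃ q ∈ U, f p ≠ f q) ∧ (∃ p ∈ U, ∃ q ∈ U, fhat p ≠ fhat q) ∧
  (∀ p ∈ U, f p ≠ fhat p) ∧
  ∀ p ∈ U, ∀ X Y : TangentSpace (𝓡 m) p,
    wedge (dE m f p)
      (fun W => Ring.inverse (cl (fhat p - f p)) * dE m fhat p W *
        Ring.inverse (cl (fhat p - f p))) X Y = 0

/-- On an open set `U`, `f` is an isothermic immersion into `ℝⁿ`: there is a smooth non-constant
`f^c : U → ℝⁿ` with `df ∧ df^c = 0`. -/
def IsIsothermicOn (U : Set M) (f : M → E n) : Prop :=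
  ContMDiffOn (𝓡 m) 𝓘(ℝ, E n) ∞ f U ∧
  (∀ p ∈ U, Function.Injective (mfderiv (𝓡 m) 𝓘(ℝ, E n) f p)) ∧
  ∃ fc : M → E n, ContMDiffOn (𝓡 m) 𝓘(ℝ, E n) ∞ fc U ∧ (∃ p ∈ U, ∃ q ∈ U, fc p ≠ fc q) ∧
    ∀ p ∈ U, ∀ X Y : TangentSpace (𝓡 m) p, wedge (dE m f p) (dE m fc p) X Y = 0

/-- On an open set `U`, `f` is locally isothermic: every point of `U` has a connected open
neighbourhood in `U` on which `f` is isothermic. -/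
def IsLocallyIsothermicOn (U : Set M) (f : M → E n) : Prop :=
  ∀ p ∈ U, ∃ V ⊆ U, IsOpen V ∧ IsConnected V ∧ p ∈ V ∧ IsIsothermicOn m V f

/-! ### Darboux pairs of isothermic surfaces in `Sⁿ` -/

/-- The open subset of `M` on which neither `f` nor `f̂` takes the value `v`. -/
def finiteSet (φ : M → Z n) (v : S n) : Set M := {p | fst φ p ≠ v ∧ snd φ p ≠ v}

/-- Darboux pairs of isothermic surfaces in `Sⁿ`: `M` is a surface and, whichever point `v` of
`Sⁿ` is chosen as the point at infinity, stereographic projection `Sⁿ ∖ {v} → ℝⁿ` turns `(f, f̂)`,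
where both are finite, into a Darboux pair of maps into `ℝⁿ` both of which are locally
isothermic. -/
def IsDarbouxPairOfIsothermicSurfaces (φ : M → Z n) : Prop :=
  m = 2 ∧ ∀ v : S n,
    IsDarbouxPairOn m (finiteSet φ v)
      (fun p => stereographic' n v (fst φ p)) (fun p => stereographic' n v (snd φ p)) ∧
    IsLocallyIsothermicOn m (finiteSet φ v) (fun p => stereographic' n v (fst φ p)) ∧
    IsLocallyIsothermicOn m (finiteSet φ v) (fun p => stereographic' n v (snd φ p))

end Maps

end PointPairs

end

/-! Both conditions reduce to one pointwise equation of first order, `FlatRel`. For vectors `a, b,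
a', b'` it records the scalar and the bivector parts of the Clifford identity `a b' = a' b`;
`cl_mul_sub_eq_zero_iff` shows that nothing is lost.

On the Lie algebra side, let `L, L'` be lifts of `f(p), f̂(p)`. An element `ξ` of `Ad(g)𝔭`
interchanges the plane `⟨L, L'⟩` with its Euclidean orthogonal complement and is determined by `a =
ξ L` and `b = ξ L'`. The commutator of two such elements acts on the plane through the number `(a,
b') - (a', b)` and on the complement through the bivector `a ∧ b' - a' ∧ b`, so it vanishes exactly
when `a b' = a' b` (`commutator_eq_zero_iff`).

Stereographic projection from `v` lifts to an isometric copy of `ℝⁿ` inside the light cone. It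
yields an isometry `normalIso` of `ℝⁿ` onto the complement of `⟨L, L'⟩` for either order of the two
points, and the two isometries differ by the reflection in `g = f̂ - f` (`normalIso_reflG`). As `g⁻¹
w g⁻¹` is that reflection of `w` divided by `|g|²`, abelian tangent spaces are equivalent to the
Darboux equation, point by point (`abelian_iff_flatAt`).

Two facts remain. Dimension: for three independent directions the relation forces `b_i = l_i a_i`
with `l_i = -l_j` for `i ≠ j`, so all `l_i` vanish, which contradicts that `f̂` is an immersion
(`le_two_of_flatRel`). Isothermicity: the Darboux equation makes `g⁻¹ df̂ g⁻¹` closed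
(`fderiv_dualForm_symm`), so on small balls it has a primitive, which serves as `f^c`; since the
equation is symmetric in the pair (`FlatAt.swap`), the same holds for `f̂`. -/

noncomputable section

namespace PointPairs

open scoped RealInnerProductSpace
open Topology

/-! ### The flatness relation and the Clifford algebra -/

/-- The relation `a b' = a' b` in the Clifford algebra, in terms of vectors. -/
def FlatRel {V : Type*} [NormedAddCommGroup V] [InnerProductSpace ℝ V] (a b a' b' : V) : Prop :=
  ⟪a, b'⟫ = ⟪a', b⟫ ∧ ∀ u : V, ⟪a, u⟫ • b' - ⟪b', u⟫ • a - ⟪a', u⟫ • b + ⟪b, u⟫ • a' = 0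

theorem FlatRel.smul {V : Type*} [NormedAddCommGroup V] [InnerProductSpace ℝ V] {a b a' b' : V}
    (h : FlatRel a b a' b') (s : ℝ) : FlatRel a (s • b) a' (s • b') := by
  refine ⟨?_, fun u => ?_⟩
  · rw [inner_smul_right, inner_smul_right, h.1]
  · have := congrArg (s • ·) (h.2 u)
    simp only [smul_zero] at this
    rw [← this]
    simp only [inner_smul_left, smul_smul, RCLike.conj_to_real]
    module

theorem FlatRel.symm {V : Type*} [NormedAddCommGroup V] [InnerProductSpace ℝ V] {a b a' b' : V}
    (h : FlatRel a b a' b') : FlatRel b a b' a' := by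
  refine ⟨?_, fun u => ?_⟩
  · rw [real_inner_comm, ← h.1, real_inner_comm]
  · rw [← h.2 u]; abel

theorem FlatRel.map {V W : Type*} [NormedAddCommGroup V] [InnerProductSpace ℝ V]
    [NormedAddCommGroup W] [InnerProductSpace ℝ W] {a b a' b' : V} (h : FlatRel a b a' b')
    (e : V ≃ₗᵢ[ℝ] W) : FlatRel (e a) (e b) (e a') (e b') := by
  refine ⟨?_, fun u => ?_⟩
  · simpa using h.1
  · have := congrArg e (h.2 (e.symm u))
    have hi : ∀ v : V, ⟪v, e.symm u⟫ = ⟪e v, u⟫ := fun v => by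
      rw [← e.inner_map_map, e.apply_symm_apply]
    simpa [hi] using this

variable {n : ℕ}

theorem cl_add_swap (a b : E n) :
    cl a * cl b + cl b * cl a = algebraMap ℝ (Cl n) (-2 * ⟪a, b⟫) := by
  rw [cl, cl, CliffordAlgebra.ι_mul_ι_add_swap]
  congr 1
  simp only [QuadraticMap.polar, _root_.neg_apply, LinearMap.BilinMap.toQuadraticMap_apply,
    innerₗ_apply_apply, inner_add_left, inner_add_right]
  rw [real_inner_comm a b]
  ring

theorem cl_mul_self (a : E n) : cl a * cl a = algebraMap ℝ (Cl n) (-‖a‖ ^ 2) := by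
  rw [cl, CliffordAlgebra.ι_sq_scalar]
  simp

theorem algebraMap_cl_injective : Function.Injective (algebraMap ℝ (Cl n)) :=
  (algebraMap ℝ (Cl n)).injective

theorem cl_eq_zero {a : E n} (h : cl a = 0) : a = 0 := by
  have h1 := cl_mul_self a
  rw [h, mul_zero, eq_comm, map_eq_zero] at h1
  simpa using h1

theorem cl_sub (a b : E n) : cl (a - b) = cl a - cl b := map_sub _ a b
theorem cl_add (a b : E n) : cl (a + b) = cl a + cl b := map_add _ a b
theorem cl_smul (r : ℝ) (a : E n) : cl (r • a) = r • cl a := map_smul _ r a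

theorem cl_mul_comm (a b : E n) : cl a * cl b = -(cl b * cl a) - (2 * ⟪a, b⟫) • 1 := by
  have := cl_add_swap a b
  rw [Algebra.algebraMap_eq_smul_one] at this
  rw [eq_sub_of_add_eq this]
  module

/-- The scalar part of `a b` is central, so the commutator with a vector sees only the bivector
part. -/
theorem cl_commutator (a b u : E n) :
    cl a * cl b * cl u - cl u * (cl a * cl b) = (2 : ℝ) • cl (⟪a, u⟫ • b - ⟪b, u⟫ • a) := by
  have h1 : cl a * cl b * cl u = -(cl a * cl u * cl b) - (2 * ⟪b, u⟫) • cl a := by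
    rw [mul_assoc, cl_mul_comm b u, mul_sub, mul_neg, mul_smul_comm, mul_one, mul_assoc]
  rw [h1, cl_mul_comm a u, cl_sub, cl_smul, cl_smul, sub_mul, neg_mul, smul_mul_assoc, one_mul,
    mul_assoc]
  module

theorem cl_mul_sub_eq_zero_iff (a b a' b' : E n) :
    cl a * cl b' - cl a' * cl b = 0 ↔ FlatRel a b a' b' := by
  constructor
  · intro h
    refine ⟨?_, fun u => ?_⟩
    -- Adding the identity to its reversal leaves only the scalar part.
    · have h2 : cl b' * cl a - cl b * cl a' = 0 := by
        have := congrArg CliffordAlgebra.reverse h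
        simpa [cl, CliffordAlgebra.reverse.map_mul] using this
      have h3 := cl_add_swap a b'
      have h4 := cl_add_swap a' b
      rw [sub_eq_zero.1 h, sub_eq_zero.1 h2, h4] at h3
      have := algebraMap_cl_injective h3
      linarith
    · have h1 := cl_commutator a b' u
      have h2 := cl_commutator a' b u
      rw [sub_eq_zero.1 h, h2] at h1
      have h3 := smul_right_injective _ (two_ne_zero' ℝ) h1
      apply cl_eq_zero
      rw [show ⟪a, u⟫ • b' - ⟪b', u⟫ • a - ⟪a', u⟫ • b + ⟪b, u⟫ • a' =
        (⟪a, u⟫ • b' - ⟪b', u⟫ • a) - (⟪a', u⟫ • b - ⟪b, u⟫ • a') by abel, cl_sub, ← h3, sub_self]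
  · rintro ⟨h1, h2⟩
    let B := EuclideanSpace.basisFun (Fin n) ℝ
    -- Multiplying the bivector identity at `u = e_i` by `e_i` and summing over an orthonormal basis
    -- recovers Clifford products.
    have key : ∀ v w : E n, ∑ i, cl (B i) * cl (⟪v, B i⟫ • w) = cl v * cl w := by
      intro v w
      have : cl v = ∑ i, ⟪v, B i⟫ • cl (B i) := by
        conv_lhs => rw [← B.sum_repr' v]
        simp only [cl, map_sum, map_smul, real_inner_comm]
      rw [this, Finset.sum_mul]
      simp only [cl_smul, smul_mul_assoc, mul_smul_comm]
    have hs : ∑ i, cl (B i) *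
        cl (⟪a, B i⟫ • b' - ⟪b', B i⟫ • a - ⟪a', B i⟫ • b + ⟪b, B i⟫ • a') = 0 := by
      refine Finset.sum_eq_zero fun i _ => ?_
      rw [h2, show cl (0 : E n) = 0 from map_zero _, mul_zero]
    simp only [cl_add, cl_sub, mul_add, mul_sub, Finset.sum_add_distrib, Finset.sum_sub_distrib,
      key] at hs
    rw [cl_mul_comm b' a, cl_mul_comm b a', real_inner_comm, h1, real_inner_comm b a'] at hs
    have h3 : (2 : ℝ) • (cl a * cl b' - cl a' * cl b) = 0 := by
      rw [← hs]; module
    exact (smul_eq_zero.1 h3).resolve_left two_ne_zero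

/-- The reflection of `v` in the hyperplane orthogonal to `g`. -/
def reflG {V : Type*} [NormedAddCommGroup V] [InnerProductSpace ℝ V] (g v : V) : V :=
  v - (2 * ⟪g, v⟫ / ‖g‖ ^ 2) • g

theorem ring_inverse_cl {g : E n} (hg : g ≠ 0) : Ring.inverse (cl g) = -(‖g‖ ^ 2)⁻¹ • cl g := by
  have h0 : ‖g‖ ^ 2 ≠ 0 := by simpa using hg
  have h1 : cl g * (-(‖g‖ ^ 2)⁻¹ • cl g) = 1 := by
    rw [mul_smul_comm, cl_mul_self, Algebra.algebraMap_eq_smul_one, smul_smul]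
    simp [h0]
  have h2 : (-(‖g‖ ^ 2)⁻¹ • cl g) * cl g = 1 := by
    rw [smul_mul_assoc, cl_mul_self, Algebra.algebraMap_eq_smul_one, smul_smul]
    simp [h0]
  exact Ring.inverse_unit (⟨cl g, -(‖g‖ ^ 2)⁻¹ • cl g, h1, h2⟩ : (Cl n)ˣ)

theorem inverse_cl_mul_mul {g : E n} (hg : g ≠ 0) (v : E n) :
    Ring.inverse (cl g) * cl v * Ring.inverse (cl g) = cl ((‖g‖ ^ 2)⁻¹ • reflG g v) := by
  have h0 : ‖g‖ ^ 2 ≠ 0 := by simpa using hg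
  rw [ring_inverse_cl hg, smul_mul_assoc, mul_smul_comm, smul_mul_assoc, cl_mul_comm g v, sub_mul,
    neg_mul, mul_assoc, cl_mul_self, Algebra.algebraMap_eq_smul_one, smul_mul_assoc, one_mul,
    mul_smul_comm, mul_one, reflG, cl_smul, cl_sub, cl_smul]
  match_scalars <;> field_simp

/-! ### Reflections and the linear algebra of the flatness relation. -/

section Reflection

variable {V : Type*} [NormedAddCommGroup V] [InnerProductSpace ℝ V]

theorem reflG_eq_reflection (g v : V) : reflG g v = (ℝ ∙ g)ᗮ.reflection v := by
  rw [Submodule.reflection_orthogonal_apply, Submodule.reflection_singleton_apply, reflG]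
  simp only [RCLike.ofReal_real_eq_id, id_eq]
  module

theorem reflG_reflG (g v : V) : reflG g (reflG g v) = v := by
  rw [reflG_eq_reflection, reflG_eq_reflection, Submodule.reflection_reflection]

theorem reflG_neg (g v : V) : reflG (-g) v = reflG g v := by
  simp [reflG, neg_div]

/-- The reflection is an isometric involution, so applying it to all four vectors moves it from `b,
b'` to `a, a'`. The sign of `g` is that of `f̂ - f` when the pair is reversed. -/
theorem FlatRel.swap {g a b a' b' : V} (h : FlatRel a (reflG g b) a' (reflG g b')) :
    FlatRel b (reflG (-g) a) b' (reflG (-g) a') := by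
  have := (h.map (ℝ ∙ g)ᗮ.reflection).symm
  simpa only [← reflG_eq_reflection, reflG_reflG, reflG_neg] using this

/-- Evaluating the bivector identity at a vector dual to `a'` and orthogonal to `a` places `b` in
the span of `a` and `a'`. -/
theorem FlatRel.exists_eq {a b a' b' : V} (h : FlatRel a b a' b')
    (hi : ∀ r s : ℝ, r • a + s • a' = 0 → r = 0 ∧ s = 0) :
    ∃ u : V, ⟪a, u⟫ = 0 ∧ ⟪a', u⟫ = 1 ∧ b = ⟪b, u⟫ • a' - ⟪b', u⟫ • a := by
  have ha : a ≠ 0 := by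
    rintro rfl
    simpa using (hi 1 0 (by simp)).1
  have ha2 : ‖a‖ ^ 2 ≠ 0 := by simpa using ha
  -- The Gram–Schmidt component of `a'` orthogonal to `a`, with denominators cleared.
  obtain ⟨w, hw⟩ : ∃ w, w = ‖a‖ ^ 2 • a' - ⟪a, a'⟫ • a := ⟨_, rfl⟩
  have hw0 : w ≠ 0 := by
    intro h0
    rw [hw] at h0
    exact ha2 (hi (-⟪a, a'⟫) (‖a‖ ^ 2) (by rw [← h0]; module)).2
  have haw : ⟪a, w⟫ = 0 := by
    rw [hw, inner_sub_right, inner_smul_right, inner_smul_right, real_inner_self_eq_norm_sq]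
    ring
  have hww : ⟪w, w⟫ = ‖a‖ ^ 2 * ⟪a', w⟫ := by
    have : ⟪w, w⟫ = ⟪‖a‖ ^ 2 • a' - ⟪a, a'⟫ • a, w⟫ := by rw [← hw]
    rw [this, inner_sub_left, inner_smul_left, inner_smul_left, haw]
    simp
  have hw1 : ⟪a', w⟫ ≠ 0 := by
    intro h0
    rw [h0, mul_zero, inner_self_eq_zero] at hww
    exact hw0 hww
  refine ⟨⟪a', w⟫⁻¹ • w, by rw [inner_smul_right, haw, mul_zero],
    by rw [inner_smul_right, inv_mul_cancel₀ hw1], ?_⟩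
  have := h.2 (⟪a', w⟫⁻¹ • w)
  rw [inner_smul_right a, haw, inner_smul_right a', inv_mul_cancel₀ hw1, mul_zero, zero_smul,
    one_smul] at this
  rw [← sub_eq_zero, ← neg_eq_zero, ← this]
  module

theorem FlatRel.eq_neg {a b a' b' : V} (h : FlatRel a b a' b')
    (hi : ∀ r s : ℝ, r • a + s • a' = 0 → r = 0 ∧ s = 0) {l k : ℝ} (hb : b = l • a)
    (hb' : b' = k • a') : l = -k := by
  obtain ⟨u, h1, h2, h3⟩ := h.exists_eq hi
  have : ⟪b, u⟫ = 0 := by rw [hb, inner_smul_left, h1, mul_zero]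
  have h4 : ⟪b', u⟫ = k := by rw [hb', inner_smul_left, h2]; simp
  rw [this, h4, hb] at h3
  have := (hi (l + k) 0 (by rw [zero_smul, add_zero, add_smul, h3]; module)).1
  linarith

/-- The vector `b` lies in the two planes spanned by `a, a'` and by `a, a''`, which meet in the line
of `a`. -/
theorem FlatRel.exists_smul {a b a' b' a'' b'' : V} (h : FlatRel a b a' b')
    (h' : FlatRel a b a'' b'')
    (hi : ∀ r s t : ℝ, r • a + s • a' + t • a'' = 0 → r = 0 ∧ s = 0 ∧ t = 0) :
    ∃ l : ℝ, b = l • a := by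
  obtain ⟨u, -, -, h3⟩ := h.exists_eq fun r s e =>
    ⟨(hi r s 0 (by simpa using e)).1, (hi r s 0 (by simpa using e)).2.1⟩
  obtain ⟨u', -, -, h3'⟩ := h'.exists_eq fun r s e =>
    ⟨(hi r 0 s (by simpa using e)).1, (hi r 0 s (by simpa using e)).2.2⟩
  have := (hi (⟪b'', u'⟫ - ⟪b', u⟫) ⟪b, u⟫ (-⟪b, u'⟫) (by
    rw [← sub_eq_zero.2 (h3.symm.trans h3')]; module)).2.1
  refine ⟨-⟪b', u⟫, ?_⟩
  rw [this] at h3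
  rw [h3]; module

/-- The pairwise flatness relation forces dimension at most two. -/
theorem le_two_of_flatRel {m : ℕ} (α β : E m →ₗ[ℝ] V) (hα : Function.Injective α)
    (hβ : Function.Injective β) (h : ∀ X Y, FlatRel (α X) (β X) (α Y) (β Y)) : m ≤ 2 := by
  by_contra! hm
  -- The standard basis indexed by `ℕ`; the default value 0 plays no role, as only the indices 0, 1,
  -- 2 occur and `2 < m`.
  let e : ℕ → E m := fun i => if hi : i < m then EuclideanSpace.single ⟨i, hi⟩ 1 else 0
  have key : ∀ i j k : ℕ, i < m → j < m → k < m → i ≠ j → i ≠ k → j ≠ k → ∀ r s t : ℝ,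
      r • α (e i) + s • α (e j) + t • α (e k) = 0 → r = 0 ∧ s = 0 ∧ t = 0 := by
    intro i j k hi hj hk hij hik hjk r s t h0
    rw [← map_smul, ← map_smul, ← map_smul, ← map_add, ← map_add] at h0
    have h1 := hα (h0.trans (map_zero α).symm)
    have h2 := congrArg (fun v : E m => v ⟨i, hi⟩) h1
    have h3 := congrArg (fun v : E m => v ⟨j, hj⟩) h1
    have h4 := congrArg (fun v : E m => v ⟨k, hk⟩) h1
    simp [e, hi, hj, hk, hij, hik, hjk, hij.symm, hik.symm, hjk.symm, Fin.ext_iff] at h2 h3 h4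
    exact ⟨h2, h3, h4⟩
  obtain ⟨l0, h0⟩ := (h (e 0) (e 1)).exists_smul (h (e 0) (e 2))
    (key 0 1 2 (by omega) (by omega) (by omega) (by omega) (by omega) (by omega))
  obtain ⟨l1, h1⟩ := (h (e 1) (e 0)).exists_smul (h (e 1) (e 2))
    (key 1 0 2 (by omega) (by omega) (by omega) (by omega) (by omega) (by omega))
  obtain ⟨l2, h2⟩ := (h (e 2) (e 0)).exists_smul (h (e 2) (e 1))
    (key 2 0 1 (by omega) (by omega) (by omega) (by omega) (by omega) (by omega))
  have key2 : ∀ i j k : ℕ, i < m → j < m → k < m → i ≠ j → i ≠ k → j ≠ k → ∀ r s : ℝ,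
      r • α (e i) + s • α (e j) = 0 → r = 0 ∧ s = 0 := by
    intro i j k hi hj hk hij hik hjk r s h0
    have := key i j k hi hj hk hij hik hjk r s 0 (by simpa using h0)
    exact ⟨this.1, this.2.1⟩
  have e01 := (h (e 0) (e 1)).eq_neg
    (key2 0 1 2 (by omega) (by omega) (by omega) (by omega) (by omega) (by omega)) h0 h1
  have e02 := (h (e 0) (e 2)).eq_neg
    (key2 0 2 1 (by omega) (by omega) (by omega) (by omega) (by omega) (by omega)) h0 h2
  have e12 := (h (e 1) (e 2)).eq_neg
    (key2 1 2 0 (by omega) (by omega) (by omega) (by omega) (by omega) (by omega)) h1 h2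
  -- Three numbers that are pairwise opposite all vanish.
  have hl : l0 = 0 := by linarith
  rw [hl, zero_smul] at h0
  have h5 := hβ (h0.trans (map_zero β).symm)
  have h6 := congrArg (fun v : E m => v ⟨0, by omega⟩) h5
  simp [e, show 0 < m by omega] at h6

/-- The derivative of `|g|⁻² R_g w` along a curve. -/
theorem hasDerivAt_inv_smul_reflG {G W : ℝ → V} {G' W' : V} {t : ℝ} (hG : HasDerivAt G G' t)
    (hW : HasDerivAt W W' t) (h0 : G t ≠ 0) :
    HasDerivAt (fun s => (‖G s‖ ^ 2)⁻¹ • reflG (G s) (W s))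
      ((‖G t‖ ^ 2)⁻¹ • reflG (G t) W' - (2 * ⟪G t, G'⟫ / (‖G t‖ ^ 2) ^ 2) • W t
        - (2 * ⟪G', W t⟫ / (‖G t‖ ^ 2) ^ 2) • G t
        + (8 * ⟪G t, W t⟫ * ⟪G t, G'⟫ / (‖G t‖ ^ 2) ^ 3) • G t
        - (2 * ⟪G t, W t⟫ / (‖G t‖ ^ 2) ^ 2) • G') t := by
  have hN : ‖G t‖ ^ 2 ≠ 0 := by simpa using h0
  have h1 : HasDerivAt (fun s => ‖G s‖ ^ 2) (2 * ⟪G t, G'⟫) t := hG.norm_sq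
  have h2 := (((hG.inner ℝ hW).const_mul 2).div h1 hN).smul hG
  have h3 := (h1.inv hN).smul (hW.sub h2)
  refine h3.congr_deriv ?_
  simp only [reflG, Pi.smul_apply', Pi.sub_apply, Pi.inv_apply, Pi.div_apply]
  match_scalars <;> field_simp
  ring

/-- The part of the derivative of `|g|⁻² R_g dh` that does not involve second derivatives is
symmetric. -/
theorem symmetric_of_flatRel {g p q p' q' : V} (hg : g ≠ 0)
    (h : FlatRel p (reflG g q) p' (reflG g q')) :
    - (2 * ⟪g, q - p⟫ / (‖g‖ ^ 2) ^ 2) • q' - (2 * ⟪q - p, q'⟫ / (‖g‖ ^ 2) ^ 2) • g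
        + (8 * ⟪g, q'⟫ * ⟪g, q - p⟫ / (‖g‖ ^ 2) ^ 3) • g
        - (2 * ⟪g, q'⟫ / (‖g‖ ^ 2) ^ 2) • (q - p) =
    - (2 * ⟪g, q' - p'⟫ / (‖g‖ ^ 2) ^ 2) • q - (2 * ⟪q' - p', q⟫ / (‖g‖ ^ 2) ^ 2) • g
        + (8 * ⟪g, q⟫ * ⟪g, q' - p'⟫ / (‖g‖ ^ 2) ^ 3) • g
        - (2 * ⟪g, q⟫ / (‖g‖ ^ 2) ^ 2) • (q' - p') := by
  have hN : ‖g‖ ^ 2 ≠ 0 := by simpa using hg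
  obtain ⟨h1, h2⟩ := h
  -- The bivector identity is needed only at `u = g`: with the scalar identity, the difference of
  -- the two sides is `2 / |g|⁴` times it.
  replace h2 := h2 g
  simp only [reflG, inner_sub_right, inner_sub_left, inner_smul_right,
    real_inner_self_eq_norm_sq, real_inner_comm g, real_inner_comm q q'] at h1 h2 ⊢
  generalize ‖g‖ ^ 2 = N at *
  have h3 : ⟪p, q'⟫ = ⟪p', q⟫ + 2 * (⟪g, q'⟫ * ⟪g, p⟫ - ⟪g, q⟫ * ⟪g, p'⟫) / N := by
    field_simp at h1 ⊢
    linarith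
  rw [h3, ← sub_eq_zero]
  trans (2 / N ^ 2 : ℝ) • (0 : V)
  · rw [← h2]
    match_scalars <;> field_simp <;> ring
  · simp

end Reflection

/-! ### Lorentz geometry -/

theorem lor_comm (u v : Lor n) : lor u v = lor v u := by
  simp only [lor, real_inner_comm, mul_comm]

theorem lor_add_left (u v w : Lor n) : lor (u + v) w = lor u w + lor v w := by
  simp only [lor, Prod.fst_add, Prod.snd_add, inner_add_left]; ring

theorem lor_smul_left (r : ℝ) (u v : Lor n) : lor (r • u) v = r * lor u v := by
  simp only [lor, Prod.smul_fst, Prod.smul_snd, real_inner_smul_left, smul_eq_mul]; ring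

theorem lor_neg_left (u v : Lor n) : lor (-u) v = -lor u v := by
  simp only [lor, Prod.fst_neg, Prod.snd_neg, inner_neg_left]; ring

theorem lor_sub_left (u v w : Lor n) : lor (u - v) w = lor u w - lor v w := by
  simp only [lor, Prod.fst_sub, Prod.snd_sub, inner_sub_left]; ring

theorem lor_add_right (u v w : Lor n) : lor u (v + w) = lor u v + lor u w := by
  rw [lor_comm, lor_add_left, lor_comm v, lor_comm w]

theorem lor_smul_right (r : ℝ) (u v : Lor n) : lor u (r • v) = r * lor u v := by
  rw [lor_comm, lor_smul_left, lor_comm v]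

theorem lor_neg_right (u v : Lor n) : lor u (-v) = -lor u v := by
  rw [lor_comm, lor_neg_left, lor_comm v]

theorem lor_sub_right (u v w : Lor n) : lor u (v - w) = lor u v - lor u w := by
  rw [lor_comm, lor_sub_left, lor_comm v, lor_comm w]

theorem lor_zero_left (u : Lor n) : lor 0 u = 0 := by simp [lor]

theorem lor_lift_self (x : S n) : lor (lift x) (lift x) = 0 := (lift_mem x).1

theorem lor_lift_lift_neg {x y : S n} (h : x ≠ y) : lor (lift x) (lift y) < 0 := by
  have h1 : ⟪(x : E (n + 1)), (y : E (n + 1))⟫ < 1 := by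
    rw [inner_lt_one_iff_real_of_norm_eq_one (by simp) (by simp)]
    exact fun h' => h (Subtype.ext h')
  simp only [lor, lift]
  linarith

/-- Future null vectors have non-positive product. -/
theorem lor_nonpos {v w : Lor n} (hv : lor v v = 0) (hw : lor w w = 0) (hv' : 0 ≤ v.2)
    (hw' : 0 ≤ w.2) : lor v w ≤ 0 := by
  simp only [lor, real_inner_self_eq_norm_sq] at hv hw
  have h1 : ‖v.1‖ = v.2 := (pow_left_inj₀ (norm_nonneg _) hv' two_ne_zero).1 (by linarith)
  have h2 : ‖w.1‖ = w.2 := (pow_left_inj₀ (norm_nonneg _) hw' two_ne_zero).1 (by linarith)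
  have := real_inner_le_norm v.1 w.1
  rw [h1, h2] at this
  simp only [lor]
  linarith

/-- The Lorentz product with a fixed vector, as a continuous linear form. -/
def lorL (e : Lor n) : Lor n →L[ℝ] ℝ :=
  (innerSL ℝ e.1).comp (ContinuousLinearMap.fst ℝ _ _) - e.2 • ContinuousLinearMap.snd ℝ _ _

theorem lorL_apply (e u : Lor n) : lorL e u = lor u e := by
  rw [lor_comm]
  simp [lorL, lor]

/-- The Lorentz reflection in the hyperplane orthogonal to `e`. -/
def lorReflL (e : Lor n) : Lor n →L[ℝ] Lor n :=
  ContinuousLinearMap.id ℝ _ - (2 / lor e e) • (lorL e).smulRight e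

theorem lorReflL_apply (e u : Lor n) : lorReflL e u = u - (2 * lor u e / lor e e) • e := by
  simp [lorReflL, lorL_apply, smul_smul]
  ring_nf

theorem lorReflL_lorReflL {e : Lor n} (he : 0 < lor e e) (u : Lor n) :
    lorReflL e (lorReflL e u) = u := by
  have := he.ne'
  simp only [lorReflL_apply, lor_sub_left, lor_smul_left]
  match_scalars <;> field_simp
  ring

theorem lor_lorReflL {e : Lor n} (he : 0 < lor e e) (u v : Lor n) :
    lor (lorReflL e u) (lorReflL e v) = lor u v := by
  have := he.ne'
  simp only [lorReflL_apply, lor_sub_left, lor_smul_left, lor_sub_right, lor_smul_right,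
    lor_comm e v]
  field_simp
  ring

/-- If the image `Rv` were not future pointing, `-Rv` and `v` would have product at most 0. That
product is `2 (v, e)² / (e, e)`, so `v` would be orthogonal to `e` and hence fixed. -/
theorem lorReflL_mem {e : Lor n} (he : 0 < lor e e) {v : Lor n} (hv : v ∈ futureCone n) :
    lorReflL e v ∈ futureCone n := by
  obtain ⟨h0, hpos⟩ := hv
  have h1 : lor (lorReflL e v) (lorReflL e v) = 0 := (lor_lorReflL he v v).trans h0
  refine ⟨h1, ?_⟩
  by_contra! hneg
  have h2 := lor_nonpos (v := -lorReflL e v) (w := v) (by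
    rw [lor_neg_left, lor_neg_right, h1]; simp) h0 (by simpa using hneg) hpos.le
  rw [lor_neg_left, lorReflL_apply, lor_sub_left, lor_smul_left, h0, lor_comm e v] at h2
  have h3 : (lor v e) ^ 2 ≤ 0 := by
    have h4 : 2 * lor v e / lor e e * lor v e = 2 / lor e e * (lor v e) ^ 2 := by ring
    rw [zero_sub, neg_neg, h4] at h2
    have : 0 < 2 / lor e e := by positivity
    exact nonpos_of_mul_nonpos_right h2 this
  have h4 : lor v e = 0 := by nlinarith
  rw [lorReflL_apply, h4] at hneg
  simp at hneg
  linarith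

/-- Reflections in spacelike vectors belong to `O⁺(n + 1, 1)`. -/
def lorRefl (e : Lor n) (he : 0 < lor e e) : OPlus n :=
  ⟨ContinuousLinearEquiv.equivOfInverse (lorReflL e) (lorReflL e) (lorReflL_lorReflL he)
    (lorReflL_lorReflL he), lor_lorReflL he, fun v =>
      ⟨fun h => by simpa [lorReflL_lorReflL he] using lorReflL_mem he h, lorReflL_mem he⟩⟩

theorem smul_eq_of_apply {g : OPlus n} {x y : S n} {k : ℝ} (h : g.1 (lift x) = k • lift y) :
    g • x = y := by
  have hpos := ((g.2.2 (lift x)).2 (lift_mem x)).2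
  rw [h] at hpos
  refine Subtype.ext ?_
  change (g.1 (lift x)).2⁻¹ • (g.1 (lift x)).1 = y
  rw [h]
  have hk : k ≠ 0 := by
    rintro rfl
    simp at hpos
  simp [lift, smul_smul, hk]

/-- A reflection that interchanges two light lines and fixes a third one. -/
theorem exists_smul_eq_smul_eq {x y p : S n} (hx : x ≠ p) (hy : y ≠ p) :
    ∃ g : OPlus n, g • x = y ∧ g • p = p := by
  by_cases hxy : x = y
  · exact ⟨1, by rw [one_smul, hxy], one_smul _ _⟩
  have h1 := lor_lift_lift_neg hx
  have h2 := lor_lift_lift_neg hy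
  have h3 := lor_lift_lift_neg hxy
  -- This scale makes `lift x - s • lift y` orthogonal to `lift p`, so that reflecting in it fixes
  -- `p`.
  obtain ⟨s, hs⟩ : ∃ s, s = lor (lift x) (lift p) / lor (lift y) (lift p) := ⟨_, rfl⟩
  have hs0 : 0 < s := hs ▸ div_pos_of_neg_of_neg h1 h2
  have hee : lor (lift x - s • lift y) (lift x - s • lift y) =
      -2 * s * lor (lift x) (lift y) := by
    simp only [lor_sub_left, lor_smul_left, lor_sub_right, lor_smul_right, lor_lift_self,
      lor_comm (lift y) (lift x)]
    ring
  have he : 0 < lor (lift x - s • lift y) (lift x - s • lift y) := by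
    rw [hee]; nlinarith
  refine ⟨lorRefl _ he, smul_eq_of_apply (k := s) ?_, smul_eq_of_apply (k := 1) ?_⟩
  · change lorReflL _ _ = _
    rw [lorReflL_apply, hee, lor_sub_right, lor_smul_right, lor_lift_self]
    have : 2 * (0 - s * lor (lift x) (lift y)) / (-2 * s * lor (lift x) (lift y)) = 1 := by
      have := h3.ne
      field_simp
      ring
    rw [this]
    module
  · change lorReflL _ _ = _
    rw [lorReflL_apply, lor_comm, lor_sub_left, lor_smul_left, hs, div_mul_cancel₀ _ h2.ne]
    simp

theorem exists_smul_eq (x y : S n) : ∃ g : OPlus n, g • x = y := by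
  by_cases hxy : x = y
  · exact ⟨1, by rw [one_smul, hxy]⟩
  have h3 := lor_lift_lift_neg hxy
  have hee : lor (lift x - lift y) (lift x - lift y) = -2 * lor (lift x) (lift y) := by
    simp only [lor_sub_left, lor_sub_right, lor_lift_self, lor_comm (lift y) (lift x)]
    ring
  have he : 0 < lor (lift x - lift y) (lift x - lift y) := by rw [hee]; linarith
  refine ⟨lorRefl _ he, smul_eq_of_apply (k := 1) ?_⟩
  change lorReflL _ _ = _
  rw [lorReflL_apply, hee, lor_sub_right, lor_lift_self]
  have : 2 * (0 - lor (lift x) (lift y)) / (-2 * lor (lift x) (lift y)) = 1 := by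
    have := h3.ne
    field_simp
    ring
  rw [this]
  module

/-- `O⁺(n + 1, 1)` acts transitively on `Z`. -/
theorem exists_smul_basePoint (z : Z n) : ∃ g : OPlus n, g • basePoint n = z := by
  obtain ⟨g, hg⟩ := exists_smul_eq (pole n) z.1.2
  have h1 : g • (-pole n) ≠ z.1.2 := by
    rw [← hg]
    exact fun h => (basePoint n).2 (MulAction.injective g h)
  obtain ⟨k, hk, hk'⟩ := exists_smul_eq_smul_eq h1 z.2
  refine ⟨k * g, Subtype.ext (Prod.ext ?_ ?_)⟩
  · change (k * g) • (-pole n) = _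
    rw [mul_smul, hk]
  · change (k * g) • (pole n) = _
    rw [mul_smul, hg, hk']

/-! ### The tangent spaces of `Z` in the Lie algebra -/

/-- The linear involution that is `1` on the plane spanned by `L`, `L'` and `-1` on its
orthogonal complement. -/
def planeInvol (L L' u : Lor n) : Lor n :=
  (2 / lor L L') • (lor u L' • L + lor u L • L') - u

/-- `ξ` is skew and anticommutes with the involution of the plane spanned by `L`, `L'`. -/
def IsTransvection (ξ : Lor n →L[ℝ] Lor n) (L L' : Lor n) : Prop :=
  ξ ∈ lieO n ∧ ∀ u, planeInvol L L' (ξ (planeInvol L L' u)) = -ξ u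

theorem invol_apply (u : Lor n) :
    invol n u = -lor u (lift (pole n)) • lift (-pole n) - lor u (lift (-pole n)) • lift (pole n)
      - u := by
  have h : ⟪(pole n : E (n + 1)), u.1⟫ = ⟪u.1, (pole n : E (n + 1))⟫ := real_inner_comm _ _
  refine Prod.ext ?_ ?_
  · simp [invol, lor, lift, h]
    module
  · simp [invol, lor, lift]
    ring

/-- An isometry carries the involution of a plane to that of the image plane; the scales `k`, `k'`
of the lifted points cancel. -/
theorem conj_invol_apply {g : OPlus n} {z : Z n} (hg : g • basePoint n = z) (u : Lor n) :
    g.1 (invol n (g.1.symm u)) = planeInvol (lift z.1.1) (lift z.1.2) u := by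
  have h1 : g.1 (lift (-pole n)) = (g.1 (lift (-pole n))).2 • lift z.1.1 := by
    rw [← hg]; exact apply_lift g _
  have h2 : g.1 (lift (pole n)) = (g.1 (lift (pole n))).2 • lift z.1.2 := by
    rw [← hg]; exact apply_lift g _
  generalize (g.1 (lift (-pole n))).2 = k at h1
  generalize (g.1 (lift (pole n))).2 = k' at h2
  have h3 := g.2.1 (lift (-pole n)) (lift (pole n))
  have h4 : ∀ v, lor (g.1.symm u) v = lor u (g.1 v) := fun v => by
    rw [← g.2.1 (g.1.symm u) v]; simp
  have h5 : lor (lift (-pole n)) (lift (pole n)) = -2 := by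
    simp [lor, lift]; norm_num
  rw [h1, h2, lor_smul_left, lor_smul_right, h5] at h3
  have h6 : lor (lift z.1.1) (lift z.1.2) ≠ 0 := (lor_lift_lift_neg z.2).ne
  have h7 : 2 / lor (lift z.1.1) (lift z.1.2) = -(k * k') := by
    rw [div_eq_iff h6]; linarith
  rw [invol_apply, map_sub, map_sub, map_smul, map_smul, h4, h4, h1, h2, lor_smul_right,
    lor_smul_right, planeInvol, h7, g.1.apply_symm_apply]
  module

/-- In particular `Ad(g)𝔭` depends only on the point `z`, not on the choice of `g`. -/
theorem mem_adP_iff {g : OPlus n} {z : Z n} (hg : g • basePoint n = z)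
    (ξ : Lor n →L[ℝ] Lor n) : ξ ∈ adP g ↔ IsTransvection ξ (lift z.1.1) (lift z.1.2) := by
  have hI := conj_invol_apply hg
  have hsk : ∀ u v, lor (g.1.symm u) v = lor u (g.1 v) := fun u v => by
    rw [← g.2.1 (g.1.symm u) v]; simp
  constructor
  · rintro ⟨ζ, ⟨h1, h2⟩, rfl⟩
    refine ⟨fun u v => ?_, fun u => ?_⟩
    · have := h1 (g.1.symm u) (g.1.symm v)
      rw [hsk u, lor_comm, hsk v, lor_comm] at this
      exact this
    · have := congrArg (fun T : Lor n →L[ℝ] Lor n => g.1 (T (g.1.symm u))) h2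
      simp only [ContinuousLinearMap.comp_apply, _root_.neg_apply, map_neg] at this
      simp only [ContinuousLinearMap.comp_apply, ContinuousLinearEquiv.coe_coe, ← hI,
        ContinuousLinearEquiv.symm_apply_apply, this]
  · rintro ⟨h1, h2⟩
    refine ⟨((g.1.symm : Lor n ≃L[ℝ] Lor n) : Lor n →L[ℝ] Lor n) ∘L ξ ∘L
      (g.1 : Lor n →L[ℝ] Lor n), ⟨fun u v => ?_, ?_⟩, ?_⟩
    · have := h1 (g.1 u) (g.1 v)
      simp only [ContinuousLinearMap.comp_apply, ContinuousLinearEquiv.coe_coe]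
      rw [hsk, lor_comm u, hsk, lor_comm _ (g.1 u)]
      exact this
    · refine ContinuousLinearMap.ext fun u => ?_
      have := congrArg g.1.symm (h2 (g.1 u))
      simp only [← hI, ContinuousLinearEquiv.symm_apply_apply, map_neg] at this
      simpa only [ContinuousLinearMap.comp_apply, ContinuousLinearEquiv.coe_coe,
        _root_.neg_apply] using this
    · refine ContinuousLinearMap.ext fun u => ?_
      simp

theorem planeInvol_left {L L' : Lor n} (hL : lor L L = 0) (hc : lor L L' ≠ 0) :
    planeInvol L L' L = L := by
  rw [planeInvol, hL, zero_smul, add_zero, smul_smul, div_mul_cancel₀ _ hc]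
  module

theorem planeInvol_right {L L' : Lor n} (hL' : lor L' L' = 0) (hc : lor L L' ≠ 0) :
    planeInvol L L' L' = L' := by
  rw [planeInvol, hL', lor_comm L', zero_smul, zero_add, smul_smul, div_mul_cancel₀ _ hc]
  module

theorem lor_eq_zero_of_planeInvol {L L' u : Lor n} (hL : lor L L = 0) (hL' : lor L' L' = 0)
    (hc : lor L L' ≠ 0) (h : planeInvol L L' u = -u) : lor u L = 0 ∧ lor u L' = 0 := by
  have h0 : (2 / lor L L') • (lor u L' • L + lor u L • L') = 0 := by
    rw [planeInvol] at h
    rw [← sub_eq_zero.2 h]; module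
  have h1 := congrArg (lor · L) h0
  have h2 := congrArg (lor · L') h0
  simp only [lor_smul_left, lor_add_left, hL, hL', lor_comm L' L, lor_zero_left] at h1 h2
  constructor
  · simpa [hc] using h1
  · simpa [hc] using h2

theorem IsTransvection.orthogonal {ξ : Lor n →L[ℝ] Lor n} {L L' : Lor n} (hL : lor L L = 0)
    (hL' : lor L' L' = 0) (hc : lor L L' ≠ 0) (h : IsTransvection ξ L L') :
    (lor (ξ L) L = 0 ∧ lor (ξ L) L' = 0) ∧ lor (ξ L') L = 0 ∧ lor (ξ L') L' = 0 := by
  constructor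
  · apply lor_eq_zero_of_planeInvol hL hL' hc
    have := h.2 L
    rwa [planeInvol_left hL hc] at this
  · apply lor_eq_zero_of_planeInvol hL hL' hc
    have := h.2 L'
    rwa [planeInvol_right hL' hc] at this

/-- On the component `w` of `u` orthogonal to the plane, anticommutation puts `ξ w` in the plane,
and skewness gives its coefficients in terms of `ξ L` and `ξ L'`. -/
theorem IsTransvection.apply_eq {ξ : Lor n →L[ℝ] Lor n} {L L' : Lor n} (hL : lor L L = 0)
    (hL' : lor L' L' = 0) (hc : lor L L' ≠ 0) (h : IsTransvection ξ L L') (u : Lor n) :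
    ξ u = (lor L L')⁻¹ • (lor u L' • ξ L + lor u L • ξ L' - lor u (ξ L') • L - lor u (ξ L) • L') := by
  obtain ⟨⟨h1, h2⟩, h3, h4⟩ := h.orthogonal hL hL' hc
  obtain ⟨w, hw⟩ : ∃ w, w = u - (lor L L')⁻¹ • (lor u L' • L + lor u L • L') := ⟨_, rfl⟩
  have hwL : lor w L = 0 := by
    rw [hw]
    simp only [lor_sub_left, lor_smul_left, lor_add_left, hL, lor_comm L' L]
    field_simp; ring
  have hwL' : lor w L' = 0 := by
    rw [hw]
    simp only [lor_sub_left, lor_smul_left, lor_add_left, hL']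
    field_simp; ring
  have hwI : planeInvol L L' w = -w := by
    rw [planeInvol, hwL, hwL']; module
  have h5 := h.2 w
  rw [hwI, map_neg, planeInvol, lor_neg_left, lor_neg_left] at h5
  have h6 := h.1 w L
  have h7 := h.1 w L'
  rw [eq_neg_of_add_eq_zero_left h6, eq_neg_of_add_eq_zero_left h7] at h5
  have h8 : lor w (ξ L) = lor u (ξ L) := by
    rw [lor_comm w, lor_comm u, hw]
    simp only [lor_sub_right, lor_smul_right, lor_add_right, h1, h2]
    ring
  have h9 : lor w (ξ L') = lor u (ξ L') := by
    rw [lor_comm w, lor_comm u, hw]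
    simp only [lor_sub_right, lor_smul_right, lor_add_right, h3, h4]
    ring
  rw [h8, h9, neg_neg, neg_neg] at h5
  have h10 : (2 : ℝ) • ξ w = -(2 / lor L L') • (lor u (ξ L') • L + lor u (ξ L) • L') := by
    rw [← sub_eq_zero] at h5 ⊢
    rw [← h5]
    module
  have h11 : ξ w = -(lor L L')⁻¹ • (lor u (ξ L') • L + lor u (ξ L) • L') := by
    have := congrArg ((2 : ℝ)⁻¹ • ·) h10
    simp only [smul_smul] at this
    rw [inv_mul_cancel₀ two_ne_zero, one_smul] at this
    rw [this]
    congr 1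
    field_simp
  have h12 : ξ u = ξ w + (lor L L')⁻¹ • (lor u L' • ξ L + lor u L • ξ L') := by
    rw [hw]
    simp only [map_sub, map_add, map_smul]
    module
  rw [h12, h11]
  module

/-- The infinitesimal transvection with prescribed values on a null pair. -/
def transvection (L L' a b : Lor n) : Lor n →L[ℝ] Lor n :=
  (lor L L')⁻¹ • ((lorL L').smulRight a + (lorL L).smulRight b - (lorL b).smulRight L
    - (lorL a).smulRight L')

theorem transvection_apply (L L' a b u : Lor n) : transvection L L' a b u =
    (lor L L')⁻¹ • (lor u L' • a + lor u L • b - lor u b • L - lor u a • L') := by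
  simp [transvection, lorL_apply]

theorem transvection_left {L L' a b : Lor n} (hL : lor L L = 0) (hc : lor L L' ≠ 0)
    (ha : lor a L = 0) (hb : lor b L = 0) : transvection L L' a b L = a := by
  rw [transvection_apply, hL, lor_comm L a, lor_comm L b, ha, hb]
  simp [smul_smul, hc]

theorem transvection_right {L L' a b : Lor n} (hL' : lor L' L' = 0) (hc : lor L L' ≠ 0)
    (ha : lor a L' = 0) (hb : lor b L' = 0) : transvection L L' a b L' = b := by
  rw [transvection_apply, hL', lor_comm L' a, lor_comm L' b, ha, hb, lor_comm L' L]
  simp [smul_smul, hc]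

theorem isTransvection_transvection {L L' a b : Lor n} (hL : lor L L = 0) (hL' : lor L' L' = 0)
    (hc : lor L L' ≠ 0) (ha : lor a L = 0) (ha' : lor a L' = 0) (hb : lor b L = 0)
    (hb' : lor b L' = 0) : IsTransvection (transvection L L' a b) L L' := by
  refine ⟨fun u v => ?_, fun u => ?_⟩
  · simp only [transvection_apply, lor_smul_left, lor_smul_right, lor_add_left, lor_add_right,
      lor_sub_left, lor_sub_right, lor_comm v]
    ring
  · simp only [planeInvol, transvection_apply, lor_smul_left, lor_add_left, lor_sub_left, ha, ha',
      hb, hb', hL, hL', lor_comm L' L, lor_comm _ a, lor_comm _ b, lor_smul_right, lor_add_right,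
      lor_sub_right]
    match_scalars <;> field_simp <;> ring

/-- The relation `a b' = a' b` for vectors of Lorentz space. -/
def LorFlat (a b a' b' : Lor n) : Prop :=
  lor a b' = lor a' b ∧
    ∀ u : Lor n, lor a u • b' - lor b' u • a - lor a' u • b + lor b u • a' = 0

theorem commutator_eq_zero_iff {ξ η : Lor n →L[ℝ] Lor n} {L L' : Lor n} (hL : lor L L = 0)
    (hL' : lor L' L' = 0) (hc : lor L L' ≠ 0) (hξ : IsTransvection ξ L L')
    (hη : IsTransvection η L L') :
    ξ * η - η * ξ = 0 ↔ LorFlat (ξ L) (ξ L') (η L) (η L') := by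
  have h1 := hξ.apply_eq hL hL' hc
  have h2 := hη.apply_eq hL hL' hc
  obtain ⟨⟨a1, a2⟩, a3, a4⟩ := hξ.orthogonal hL hL' hc
  obtain ⟨⟨b1, b2⟩, b3, b4⟩ := hη.orthogonal hL hL' hc
  generalize ξ L = a at *
  generalize ξ L' = b at *
  generalize η L = a' at *
  generalize η L' = b' at *
  have key : ∀ u, (ξ * η - η * ξ) u = (lor L L')⁻¹ •
      ((lor a u • b' - lor b' u • a - lor a' u • b + lor b u • a') +
      ((lor a b' - lor a' b) / lor L L') • (lor u L' • L - lor u L • L')) := by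
    intro u
    change ξ (η u) - η (ξ u) = _
    rw [h1 (η u), h2 (ξ u), h1 u, h2 u]
    simp only [lor_smul_left, lor_add_left, lor_sub_left, a1, a2, a3, a4, b1, b2, b3, b4, hL, hL',
      lor_comm L' L, lor_comm L a, lor_comm L' a, lor_comm L b, lor_comm L' b, lor_comm L a',
      lor_comm L' a', lor_comm L b', lor_comm L' b', lor_comm a u, lor_comm b u, lor_comm a' u,
      lor_comm b' u, lor_comm b' a, lor_comm b a', lor_comm a' a, lor_comm b' b]
    match_scalars <;> field_simp <;> ring
  constructor
  · intro h0
    -- The bivector part kills `L`, so evaluating at `L` isolates the scalar part.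
    have h3 : lor a b' - lor a' b = 0 := by
      have := key L
      rw [h0, hL, a1, b1, a3, b3, eq_comm] at this
      have h4 := congrArg (lor · L') this
      simp only [zero_smul, sub_zero, add_zero, lor_smul_left,
        _root_.zero_apply, lor_zero_left, zero_add] at h4
      field_simp at h4
      exact h4
    refine ⟨sub_eq_zero.1 h3, fun u => ?_⟩
    have := key u
    rw [h0, h3, zero_div, zero_smul, add_zero, eq_comm] at this
    exact (smul_eq_zero.1 this).resolve_left (inv_ne_zero hc)
  · rintro ⟨h3, h4⟩
    refine ContinuousLinearMap.ext fun u => ?_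
    rw [key, h4, sub_eq_zero.2 h3]
    simp

/-- The relation is homogeneous in each of the pairs `a, a'` and `b, b'`, so rescaling the lifts of
the two points does not matter. -/
theorem lorFlat_smul_iff {a b a' b' : Lor n} {s t : ℝ} (hs : s ≠ 0) (ht : t ≠ 0) :
    LorFlat (s • a) (t • b) (s • a') (t • b') ↔ LorFlat a b a' b' := by
  have key : ∀ u, lor (s • a) u • t • b' - lor (t • b') u • s • a - lor (s • a') u • t • b +
      lor (t • b) u • s • a' =
      (s * t) • (lor a u • b' - lor b' u • a - lor a' u • b + lor b u • a') := by
    intro u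
    simp only [lor_smul_left]
    module
  refine and_congr ?_ (forall_congr' fun u => ?_)
  · simp [lor_smul_left, lor_smul_right, hs, ht]
  · rw [key, smul_eq_zero, or_iff_right (mul_ne_zero hs ht)]

/-- An isometric embedding of Euclidean space into Lorentz space preserves and reflects
flatness. -/
theorem lorFlat_map_iff (J : E n →ₗ[ℝ] Lor n) (hJ : ∀ v w, lor (J v) (J w) = ⟪v, w⟫)
    (a b a' b' : E n) : LorFlat (J a) (J b) (J a') (J b') ↔ FlatRel a b a' b' := by
  have hJ0 : ∀ v, J v = 0 → v = 0 := fun v hv => by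
    have := hJ v v
    rwa [hv, lor_zero_left, eq_comm, inner_self_eq_zero] at this
  have key : ∀ r, lor (J a) (J r) • J b' - lor (J b') (J r) • J a - lor (J a') (J r) • J b +
      lor (J b) (J r) • J a' = J (⟪a, r⟫ • b' - ⟪b', r⟫ • a - ⟪a', r⟫ • b + ⟪b, r⟫ • a') := by
    intro r
    simp only [hJ, map_add, map_sub, map_smul]
  constructor
  · rintro ⟨h1, h2⟩
    exact ⟨by simpa only [hJ] using h1, fun r => hJ0 _ (by rw [← key, h2])⟩
  · rintro ⟨h1, h2⟩
    refine ⟨by simpa only [hJ] using h1, fun u => ?_⟩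
    -- Here `u` need not lie in the image of `J`. The bivector operator `B` is skew, `B u = J r` and
    -- `B (J r) = 0`, so `⟪r, r⟫ = (B u, B u) = -(u, B (B u)) = 0`.
    obtain ⟨r, hr⟩ : ∃ r, r = lor (J a) u • b' - lor (J b') u • a - lor (J a') u • b +
      lor (J b) u • a' := ⟨_, rfl⟩
    have hr' : lor (J a) u • J b' - lor (J b') u • J a - lor (J a') u • J b +
      lor (J b) u • J a' = J r := by
      rw [hr]; simp only [map_add, map_sub, map_smul]
    have h3 := key r
    rw [h2, map_zero, ← hr'] at h3
    have h4 := congrArg (lor u ·) h3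
    have h5 : ⟪r, r⟫ = 0 := by
      rw [← hJ, ← hr']
      simp only [lor_add_left, lor_sub_left, lor_smul_left, lor_add_right, lor_sub_right,
        lor_smul_right, lor_comm u, lor_zero_left, lor_comm (J a') (J a), lor_comm (J b') (J a),
        lor_comm (J b) (J a), lor_comm (J b) (J a'), lor_comm (J b') (J b),
        lor_comm (J b') (J a')] at h4 ⊢
      linarith
    rw [hr', inner_self_eq_zero.1 h5, map_zero]

theorem hasDerivAt_projAct_exp (ξ : Lor n →L[ℝ] Lor n) (x : S n) :
    HasDerivAt (fun t : ℝ => projAct (NormedSpace.exp (t • ξ)) x)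
      ((ξ (lift x)).1 - (ξ (lift x)).2 • (x : E (n + 1))) 0 := by
  have e0 : NormedSpace.exp ((0 : ℝ) • ξ) = 1 :=
    (congrArg _ (zero_smul ℝ ξ)).trans NormedSpace.exp_zero
  have h1 : HasDerivAt (fun t : ℝ => NormedSpace.exp (t • ξ)) ξ 0 := by
    have := hasDerivAt_exp_smul_const (𝕂 := ℝ) ξ (0 : ℝ)
    rwa [e0, one_mul] at this
  have h2 : HasDerivAt (fun t : ℝ => NormedSpace.exp (t • ξ) (lift x)) (ξ (lift x)) 0 :=
    ((ContinuousLinearMap.apply ℝ (Lor n) (lift x)).hasFDerivAt.comp_hasDerivAt (0 : ℝ) h1)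
  have h3 := (ContinuousLinearMap.fst ℝ (E (n + 1)) ℝ).hasFDerivAt.comp_hasDerivAt (0 : ℝ) h2
  have h4 := (ContinuousLinearMap.snd ℝ (E (n + 1)) ℝ).hasFDerivAt.comp_hasDerivAt (0 : ℝ) h2
  have h5 := (h4.inv (by simp [e0, lift])).smul h3
  refine h5.congr_deriv ?_
  simp [e0, lift]
  module

/-- The induced vector is `ξ (lift x)` modulo `lift x`, normalised to time coordinate 0. -/
theorem induces_iff (ξ : Lor n →L[ℝ] Lor n) (x : S n) (w : E (n + 1)) :
    Induces ξ x w ↔ w = (ξ (lift x)).1 - (ξ (lift x)).2 • (x : E (n + 1)) :=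
  ⟨fun h => h.unique (hasDerivAt_projAct_exp ξ x), fun h => h ▸ hasDerivAt_projAct_exp ξ x⟩

/-! ### Stereographic projection in the light cone -/

/-- The isometric inclusion of `ℝⁿ` into `ℝⁿ⁺¹` with image orthogonal to `v` that underlies
stereographic projection from `v`. -/
def stereoIncl (v : S n) : E n →ₗᵢ[ℝ] E (n + 1) :=
  (ℝ ∙ (v : E (n + 1)))ᗮ.subtypeₗᵢ.comp
    (OrthonormalBasis.fromOrthogonalSpanSingleton n
      (ne_zero_of_mem_unit_sphere v)).repr.symm.toLinearIsometry

theorem inner_stereoIncl (v : S n) (z : E n) : ⟪stereoIncl v z, (v : E (n + 1))⟫ = 0 := by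
  rw [real_inner_comm]
  exact Submodule.mem_orthogonal_singleton_iff_inner_right.1
    ((OrthonormalBasis.fromOrthogonalSpanSingleton n
      (ne_zero_of_mem_unit_sphere v)).repr.symm z).2

theorem inner_stereoIncl_stereoIncl (v : S n) (z w : E n) :
    ⟪stereoIncl v z, stereoIncl v w⟫ = ⟪z, w⟫ := (stereoIncl v).inner_map_map z w

/-- The time coordinate of the lift of `z` to a paraboloid in the light cone. -/
def height (z : E n) : ℝ := ‖z‖ ^ 2 / 4 + 1

theorem height_pos (z : E n) : 0 < height z := by
  unfold height; positivity

/-- The space coordinate of the lift of `z` to a paraboloid in the light cone. -/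
def coneFst (v : S n) (z : E n) : E (n + 1) := stereoIncl v z + (height z - 2) • (v : E (n + 1))

/-- The lift of `z` to a paraboloid in the light cone. -/
def coneLift (v : S n) (z : E n) : Lor n := (coneFst v z, height z)

/-- Inverse stereographic projection is `(4z + (|z|² - 4)v) / (|z|² + 4)`; the factor `|z|²/4 + 1`
clears the denominator, which explains `height`. -/
theorem coneLift_stereographic' {v x : S n} (hx : x ≠ v) :
    coneLift v (stereographic' n v x) = height (stereographic' n v x) • lift x := by
  have h1 : (stereographic' n v).symm (stereographic' n v x) = x :=
    (stereographic' n v).left_inv (by simpa using hx)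
  have h2 := stereographic'_symm_apply v (stereographic' n v x)
  rw [h1] at h2
  generalize stereographic' n v x = z at *
  have h3 : ((OrthonormalBasis.fromOrthogonalSpanSingleton n
      (ne_zero_of_mem_unit_sphere v)).repr.symm z : E (n + 1)) = stereoIncl v z := rfl
  simp only [h3, LinearIsometry.norm_map] at h2
  have h4 : ‖z‖ ^ 2 + 4 ≠ 0 := by positivity
  refine Prod.ext ?_ ?_
  · simp only [coneLift, coneFst, lift, Prod.smul_fst, h2, height]
    match_scalars <;> field_simp
    ring
  · simp [coneLift, lift]

/-- The derivative of `coneLift`. -/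
def coneDeriv (v : S n) (z : E n) : E n →ₗ[ℝ] Lor n where
  toFun w := (stereoIncl v w + (⟪z, w⟫ / 2) • (v : E (n + 1)), ⟪z, w⟫ / 2)
  map_add' a b := by
    refine Prod.ext ?_ ?_
    · simp only [map_add, inner_add_right, Prod.fst_add]; module
    · simp only [inner_add_right, Prod.snd_add]; ring
  map_smul' r a := by
    refine Prod.ext ?_ ?_
    · simp only [map_smul, inner_smul_right, Prod.smul_fst, RingHom.id_apply]; module
    · simp only [inner_smul_right, Prod.smul_snd, RingHom.id_apply, smul_eq_mul]; ring

theorem coneDeriv_apply (v : S n) (z w : E n) : coneDeriv v z w =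
    (stereoIncl v w + (⟪z, w⟫ / 2) • (v : E (n + 1)), ⟪z, w⟫ / 2) := rfl

theorem inner_self_S (v : S n) : ⟪(v : E (n + 1)), (v : E (n + 1))⟫ = 1 := by
  rw [real_inner_self_eq_norm_sq]; simp

theorem inner_stereoIncl' (v : S n) (z : E n) : ⟪(v : E (n + 1)), stereoIncl v z⟫ = 0 := by
  rw [real_inner_comm, inner_stereoIncl]

/-- The paraboloid is the section of the light cone by the hyperplane `lor · (lift v) = -2`, an
isometric copy of `ℝⁿ`. -/
theorem lor_coneLift (v : S n) (z z' : E n) :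
    lor (coneLift v z) (coneLift v z') = -‖z' - z‖ ^ 2 / 2 := by
  simp only [lor, coneLift, coneFst, height, inner_add_left, inner_add_right, inner_smul_left,
    inner_smul_right, inner_stereoIncl, inner_stereoIncl', inner_stereoIncl_stereoIncl,
    inner_self_S, RCLike.conj_to_real, norm_sub_sq_real, real_inner_comm z z']
  ring

theorem lor_coneDeriv_coneLift (v : S n) (z w z' : E n) :
    lor (coneDeriv v z w) (coneLift v z') = ⟪z' - z, w⟫ := by
  simp only [lor, coneLift, coneDeriv_apply, coneFst, height, inner_add_left, inner_add_right,
    inner_smul_left, inner_smul_right, inner_stereoIncl, inner_stereoIncl',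
    inner_stereoIncl_stereoIncl, inner_self_S, RCLike.conj_to_real, inner_sub_left,
    real_inner_comm z' w]
  ring

theorem lor_coneDeriv (v : S n) (z w z' w' : E n) :
    lor (coneDeriv v z w) (coneDeriv v z' w') = ⟪w, w'⟫ := by
  simp only [lor, coneDeriv_apply, inner_add_left, inner_add_right,
    inner_smul_left, inner_smul_right, inner_stereoIncl, inner_stereoIncl',
    inner_stereoIncl_stereoIncl, inner_self_S, RCLike.conj_to_real]
  ring

/-- The isometry of `ℝⁿ` onto the orthogonal complement of the plane spanned by the lifts of `z`
and `z'`. -/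
def normalIso (v : S n) (z z' : E n) : E n →ₗ[ℝ] Lor n :=
  coneDeriv v z + ((2 / ‖z' - z‖ ^ 2) • innerₗ (E n) (z' - z)).smulRight (coneLift v z)

theorem normalIso_apply (v : S n) (z z' w : E n) : normalIso v z z' w =
    coneDeriv v z w + (2 * ⟪z' - z, w⟫ / ‖z' - z‖ ^ 2) • coneLift v z := by
  simp only [normalIso, LinearMap.add_apply, LinearMap.smulRight_apply, LinearMap.smul_apply,
    innerₗ_apply_apply, smul_eq_mul]
  congr 2
  ring

theorem lor_normalIso_left (v : S n) (z z' w : E n) :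
    lor (normalIso v z z' w) (coneLift v z) = 0 := by
  rw [normalIso_apply, lor_add_left, lor_smul_left, lor_coneDeriv_coneLift, lor_coneLift]
  simp

/-- This orthogonality dictates the coefficient of `coneLift v z` in `normalIso`. -/
theorem lor_normalIso_right (v : S n) {z z' : E n} (h : z ≠ z') (w : E n) :
    lor (normalIso v z z' w) (coneLift v z') = 0 := by
  have h0 : ‖z' - z‖ ≠ 0 := by simpa [sub_eq_zero] using h.symm
  rw [normalIso_apply, lor_add_left, lor_smul_left, lor_coneDeriv_coneLift, lor_coneLift]
  field_simp
  ring

/-- Adding multiples of a null vector to vectors orthogonal to it leaves their products unchanged.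
-/
theorem lor_normalIso (v : S n) {z z' : E n} (w w' : E n) :
    lor (normalIso v z z' w) (normalIso v z z' w') = ⟪w, w'⟫ := by
  rw [normalIso_apply v z z' w', lor_add_right, lor_smul_right, lor_normalIso_left, mul_zero,
    add_zero, normalIso_apply, lor_add_left, lor_smul_left, lor_comm (coneLift v z),
    lor_coneDeriv_coneLift, lor_coneDeriv]
  simp

/-- Source of the conjugation by `g⁻¹` in the Darboux equation: tangent vectors at the two points
are compared inside one common complement. -/
theorem normalIso_reflG (v : S n) {z z' : E n} (h : z ≠ z') (w : E n) :
    normalIso v z z' (reflG (z' - z) w) = normalIso v z' z w := by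
  have h0 : ‖z' - z‖ ≠ 0 := by simpa [sub_eq_zero] using h.symm
  have h1 : z - z' = -(z' - z) := by abel
  rw [normalIso_apply, normalIso_apply, h1, norm_neg, inner_neg_left]
  obtain ⟨g, hg⟩ : ∃ g, g = z' - z := ⟨_, rfl⟩
  have hz : z' = z + g := by rw [hg]; abel
  rw [← hg] at h0 ⊢
  rw [hz]
  have hi : ⟪g, reflG g w⟫ = -⟪g, w⟫ := by
    rw [reflG, inner_sub_right, inner_smul_right, real_inner_self_eq_norm_sq]
    field_simp
    ring
  rw [hi]
  have hh : ‖z + g‖ ^ 2 = ‖z‖ ^ 2 + 2 * ⟪z, g⟫ + ‖g‖ ^ 2 := norm_add_sq_real z g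
  refine Prod.ext ?_ ?_
  · simp only [coneDeriv_apply, coneLift, coneFst, height, Prod.fst_add, Prod.fst_sub, Prod.smul_fst,
      reflG, map_sub, map_add, map_smul, inner_add_left, hh]
    match_scalars <;> field_simp
    ring
  · simp only [coneDeriv_apply, coneLift, height, Prod.snd_add, Prod.snd_sub, Prod.smul_snd, reflG,
      map_sub, map_smul, inner_add_left, hh, smul_eq_mul]
    field_simp
    ring

/-- `w` is the image of the tangent vector `ws` of `Sⁿ` at `x` under the derivative of
stereographic projection from `v`. -/
def StereoTangent (v x : S n) (w : E n) (ws : E (n + 1)) : Prop :=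
  coneDeriv v (stereographic' n v x) w = (⟪stereographic' n v x, w⟫ / 2) • lift x +
    height (stereographic' n v x) • ((ws, 0) : Lor n)

theorem StereoTangent.normalIso_eq {v x : S n} {w : E n} {ws : E (n + 1)}
    (h : StereoTangent v x w ws) (hx : x ≠ v) (z' : E n) :
    ∃ k : ℝ, normalIso v (stereographic' n v x) z' w =
      height (stereographic' n v x) • ((ws, 0) : Lor n) + k • lift x := by
  refine ⟨⟪stereographic' n v x, w⟫ / 2 + (2 * ⟪z' - stereographic' n v x, w⟫ /
    ‖z' - stereographic' n v x‖ ^ 2) * height (stereographic' n v x), ?_⟩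
  rw [normalIso_apply, coneLift_stereographic' hx, h]
  module

/-- Both sides represent the same tangent vector modulo `lift x` and are orthogonal to `lift y`; as
`lift x` is not orthogonal to `lift y`, they agree. -/
theorem StereoTangent.apply_eq {v x y : S n} {w : E n} {ws : E (n + 1)}
    (h : StereoTangent v x w ws) (hx : x ≠ v) (hy : y ≠ v) (hxy : x ≠ y)
    (hz : stereographic' n v x ≠ stereographic' n v y)
    {ξ : Lor n →L[ℝ] Lor n} (hξ : lor (ξ (lift x)) (lift y) = 0) (hi : Induces ξ x ws) :
    height (stereographic' n v x) • ξ (lift x) =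
      normalIso v (stereographic' n v x) (stereographic' n v y) w := by
  obtain ⟨k, hk⟩ := h.normalIso_eq hx (stereographic' n v y)
  have h1 : ((ws, 0) : Lor n) = ξ (lift x) - (ξ (lift x)).2 • lift x := by
    refine Prod.ext ?_ ?_
    · simp [(induces_iff ξ x ws).1 hi, lift]
    · simp [lift]
  have h2 := lor_normalIso_right v hz w
  rw [coneLift_stereographic' hy, lor_smul_right] at h2
  replace h2 := (mul_eq_zero.1 h2).resolve_left (height_pos _).ne'
  rw [hk, h1] at h2
  simp only [lor_add_left, lor_smul_left, lor_sub_left, hξ] at h2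
  have h3 : (k - height (stereographic' n v x) * (ξ (lift x)).2) *
      lor (lift x) (lift y) = 0 := by linarith
  have h4 := (mul_eq_zero.1 h3).resolve_right (lor_lift_lift_neg hxy).ne
  rw [hk, h1, show k = height (stereographic' n v x) * (ξ (lift x)).2 by linarith]
  module

theorem StereoTangent.induces {v x : S n} {w : E n} {ws : E (n + 1)}
    (h : StereoTangent v x w ws) (hx : x ≠ v) {z' : E n} {ξ : Lor n →L[ℝ] Lor n}
    (hξ : ξ (lift x) = (height (stereographic' n v x))⁻¹ •
      normalIso v (stereographic' n v x) z' w) : Induces ξ x ws := by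
  obtain ⟨k, hk⟩ := h.normalIso_eq hx z'
  have h0 := (height_pos (stereographic' n v x)).ne'
  rw [induces_iff, hξ, hk]
  simp only [smul_add, smul_smul, inv_mul_cancel₀ h0, one_smul, Prod.fst_add, Prod.snd_add,
    Prod.smul_fst, Prod.smul_snd, lift, smul_eq_mul, mul_one, zero_add]
  abel

/-- Two transvections commute if and only if the tangent vectors that they induce satisfy the
flatness relation in stereographic projection. -/
theorem commute_iff_flatRel {v x y : S n} (hx : x ≠ v) (hy : y ≠ v) (hxy : x ≠ y)
    (hz : stereographic' n v x ≠ stereographic' n v y) {a b a' b' : E n}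
    {as bs as' bs' : E (n + 1)} (ha : StereoTangent v x a as) (hb : StereoTangent v y b bs)
    (ha' : StereoTangent v x a' as') (hb' : StereoTangent v y b' bs')
    {ξ η : Lor n →L[ℝ] Lor n} (hξ : IsTransvection ξ (lift x) (lift y))
    (hη : IsTransvection η (lift x) (lift y)) (h1 : Induces ξ x as) (h2 : Induces ξ y bs)
    (h3 : Induces η x as') (h4 : Induces η y bs') :
    ξ * η - η * ξ = 0 ↔
      FlatRel a (reflG (stereographic' n v y - stereographic' n v x) b) a'
        (reflG (stereographic' n v y - stereographic' n v x) b') := by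
  have hL := lor_lift_self x
  have hL' := lor_lift_self y
  have hc := (lor_lift_lift_neg hxy).ne
  have o1 := hξ.orthogonal hL hL' hc
  have o2 := hη.orthogonal hL hL' hc
  rw [commutator_eq_zero_iff hL hL' hc hξ hη,
    ← lorFlat_smul_iff (height_pos (stereographic' n v x)).ne'
      (height_pos (stereographic' n v y)).ne',
    ha.apply_eq hx hy hxy hz o1.1.2 h1, hb.apply_eq hy hx hxy.symm hz.symm o1.2.1 h2,
    ha'.apply_eq hx hy hxy hz o2.1.2 h3, hb'.apply_eq hy hx hxy.symm hz.symm o2.2.1 h4,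
    ← lorFlat_map_iff (normalIso v (stereographic' n v x) (stereographic' n v y))
      (lor_normalIso v), normalIso_reflG v hz, normalIso_reflG v hz]

theorem exists_transvection {v x y : S n} (hx : x ≠ v) (hy : y ≠ v) (hxy : x ≠ y)
    (hz : stereographic' n v x ≠ stereographic' n v y) {a b : E n}
    {as bs : E (n + 1)} (ha : StereoTangent v x a as) (hb : StereoTangent v y b bs) :
    ∃ ξ : Lor n →L[ℝ] Lor n, IsTransvection ξ (lift x) (lift y) ∧ Induces ξ x as ∧
      Induces ξ y bs := by
  have hL := lor_lift_self x
  have hL' := lor_lift_self y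
  have hc := (lor_lift_lift_neg hxy).ne
  have h1 := lor_normalIso_left v (stereographic' n v x) (stereographic' n v y) a
  have h2 := lor_normalIso_right v hz a
  have h3 := lor_normalIso_right v hz.symm b
  have h4 := lor_normalIso_left v (stereographic' n v y) (stereographic' n v x) b
  rw [coneLift_stereographic' hx, lor_smul_right] at h1 h3
  rw [coneLift_stereographic' hy, lor_smul_right] at h2 h4
  replace h1 := (mul_eq_zero.1 h1).resolve_left (height_pos _).ne'
  replace h2 := (mul_eq_zero.1 h2).resolve_left (height_pos _).ne'
  replace h3 := (mul_eq_zero.1 h3).resolve_left (height_pos _).ne'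
  replace h4 := (mul_eq_zero.1 h4).resolve_left (height_pos _).ne'
  have hs : ∀ (r : ℝ) {u w : Lor n}, lor u w = 0 → lor (r • u) w = 0 := fun r u w h => by
    rw [lor_smul_left, h, mul_zero]
  exact ⟨transvection (lift x) (lift y)
    ((height (stereographic' n v x))⁻¹ •
      normalIso v (stereographic' n v x) (stereographic' n v y) a)
    ((height (stereographic' n v y))⁻¹ •
      normalIso v (stereographic' n v y) (stereographic' n v x) b),
    isTransvection_transvection hL hL' hc (hs _ h1) (hs _ h2) (hs _ h3) (hs _ h4),
    ha.induces hx (transvection_left hL hc (hs _ h1) (hs _ h3)),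
    hb.induces hy (transvection_right hL' hc (hs _ h2) (hs _ h4))⟩

theorem stereographic'_injOn {v x y : S n} (hx : x ≠ v) (hy : y ≠ v) (hxy : x ≠ y) :
    stereographic' n v x ≠ stereographic' n v y := fun h =>
  hxy ((stereographic' n v).injOn (by simpa using hx) (by simpa using hy) h)

/-! ### Derivatives of vector-valued maps on manifolds -/

section Derivatives

variable (m : ℕ) {M : Type*} [TopologicalSpace M] [ChartedSpace (E m) M]
variable {V W : Type*} [NormedAddCommGroup V] [NormedSpace ℝ V] [NormedAddCommGroup W]
  [NormedSpace ℝ W]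

/-- The derivative of a vector-valued map, as a linear map between vector spaces. -/
def dV (z : M → V) (p : M) : E m →L[ℝ] V := mfderiv (𝓡 m) 𝓘(ℝ, V) z p

variable {m}

theorem hasMFDerivAt_dV {z : M → V} {p : M} (hz : MDifferentiableAt (𝓡 m) 𝓘(ℝ, V) z p) :
    HasMFDerivAt (𝓡 m) 𝓘(ℝ, V) z p (dV (V := V) m z p) := hz.hasMFDerivAt

theorem dV_eq {z : M → V} {p : M} {D : E m →L[ℝ] V}
    (h : HasMFDerivAt (𝓡 m) 𝓘(ℝ, V) z p D) : dV m z p = D := h.mfderiv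

theorem dV_comp {z : M → V} {p : M} (hz : MDifferentiableAt (𝓡 m) 𝓘(ℝ, V) z p) {Φ : V → W}
    {Φ' : V →L[ℝ] W} (hΦ : HasFDerivAt Φ Φ' (z p)) :
    dV m (fun q => Φ (z q)) p = Φ'.comp (dV m z p) :=
  dV_eq (hΦ.hasMFDerivAt.comp p (hasMFDerivAt_dV hz))

theorem dV_congr {z z' : M → V} {p : M} (h : z =ᶠ[𝓝 p] z') : dV m z p = dV m z' p :=
  h.mfderiv_eq

theorem dV_const (c : V) (p : M) : dV m (fun _ : M => c) p = 0 := mfderiv_const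

theorem exists_ne_of_injective {z : M → V} {U : Set M} (hm : 0 < m) (hU : IsOpen U) {p : M}
    (hp : p ∈ U) (hz : Function.Injective (dV m z p)) : ∃ p ∈ U, ∃ q ∈ U, z p ≠ z q := by
  by_contra! h
  have h1 : z =ᶠ[𝓝 p] fun _ => z p := by
    filter_upwards [hU.mem_nhds hp] with q hq using h q hq p hp
  have h2 : dV m z p = 0 := (dV_congr h1).trans (dV_const _ _)
  have h3 := @hz (EuclideanSpace.single ⟨0, hm⟩ 1) 0 (by rw [h2]; rfl)
  simpa using congrArg (fun v : E m => v ⟨0, hm⟩) h3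

variable [IsManifold (𝓡 m) ∞ M]

theorem contDiffOn_comp_chart_symm {z : M → V} {U : Set M}
    (hz : ContMDiffOn (𝓡 m) 𝓘(ℝ, V) ∞ z U) (p : M) :
    ContDiffOn ℝ ∞ (z ∘ (chartAt (E m) p).symm)
      ((chartAt (E m) p).target ∩ (chartAt (E m) p).symm ⁻¹' U) := by
  rw [← contMDiffOn_iff_contDiffOn]
  exact hz.comp ((contMDiffOn_chart_symm (I := 𝓡 m) (n := ∞)).mono Set.inter_subset_left)
    fun y hy => hy.2

/-- The derivative of the inverse of a chart. -/
def chartSymmDeriv (p : M) (y : E m) : E m →L[ℝ] E m :=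
  mfderiv (𝓡 m) (𝓡 m) (chartAt (E m) p).symm y

/-- The derivative of the coordinate representation of a map. -/
theorem hasFDerivAt_comp_chart_symm {z : M → V} {p : M} {y : E m}
    (hy : y ∈ (chartAt (E m) p).target)
    (hz : MDifferentiableAt (𝓡 m) 𝓘(ℝ, V) z ((chartAt (E m) p).symm y)) :
    HasFDerivAt (z ∘ (chartAt (E m) p).symm)
      ((dV m z ((chartAt (E m) p).symm y)).comp (chartSymmDeriv p y)) y := by
  have h1 : MDifferentiableAt (𝓡 m) (𝓡 m) (chartAt (E m) p).symm y :=
    ((mdifferentiable_chart p).symm).mdifferentiableAt hy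
  exact ((hasMFDerivAt_dV hz).comp y h1.hasMFDerivAt).hasFDerivAt

theorem dV_eq_comp_chart {z : M → V} {p q : M}
    (hq : q ∈ (chartAt (E m) p).source) {D : E m →L[ℝ] V}
    (hD : HasFDerivAt (z ∘ (chartAt (E m) p).symm) D (chartAt (E m) p q)) :
    dV m z q = D.comp (dV m (chartAt (E m) p) q) := by
  have h1 : MDifferentiableAt (𝓡 m) (𝓡 m) (chartAt (E m) p) q :=
    (mdifferentiable_chart p).mdifferentiableAt hq
  have h2 : z =ᶠ[𝓝 q] fun r => (z ∘ (chartAt (E m) p).symm) (chartAt (E m) p r) := by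
    filter_upwards [(chartAt (E m) p).open_source.mem_nhds hq] with r hr
    simp [(chartAt (E m) p).left_inv hr]
  rw [dV_congr h2]
  exact dV_comp h1 hD

end Derivatives

/-! ### Isothermic maps from closed forms -/

section Closed

variable {V W : Type*} [NormedAddCommGroup V] [NormedSpace ℝ V] [NormedAddCommGroup W]
  [InnerProductSpace ℝ W]

/-- The form `g⁻¹ dh g⁻¹`, where `g = h - z`, of a pair of maps into a Euclidean space. -/
def dualForm (z h : V → W) (y : V) : V →L[ℝ] W :=
  (‖h y - z y‖ ^ 2)⁻¹ • (((ℝ ∙ (h y - z y))ᗮ.reflection.toContinuousLinearEquiv :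
    W →L[ℝ] W).comp (fderiv ℝ h y))

theorem dualForm_apply (z h : V → W) (y X : V) :
    dualForm z h y X = (‖h y - z y‖ ^ 2)⁻¹ • reflG (h y - z y) (fderiv ℝ h y X) := by
  simp [dualForm, reflG_eq_reflection]

theorem contDiffOn_dualForm [FiniteDimensional ℝ V] {z h : V → W} {s : Set V} (hs : IsOpen s)
    (hz : ContDiffOn ℝ ∞ z s) (hh : ContDiffOn ℝ ∞ h s) (hne : ∀ y ∈ s, z y ≠ h y) :
    ContDiffOn ℝ ∞ (dualForm z h) s := by
  rw [contDiffOn_clm_apply]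
  intro X
  have h1 : ContDiffOn ℝ ∞ (fun y => h y - z y) s := hh.sub hz
  have h2 : ContDiffOn ℝ ∞ (fun y => fderiv ℝ h y X) s :=
    ((contDiffOn_infty_iff_fderiv_of_isOpen hs).1 hh).2.clm_apply contDiffOn_const
  have h3 : ∀ y ∈ s, ‖h y - z y‖ ^ 2 ≠ 0 := fun y hy => by
    simpa [sub_eq_zero] using (hne y hy).symm
  simp only [dualForm_apply, reflG]
  exact (ContDiffOn.inv (h1.norm_sq ℝ) h3).smul
    (h2.sub (((contDiffOn_const.mul (h1.inner ℝ h2)).div (h1.norm_sq ℝ) h3).smul h1))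

/-- If `dz ∧ g⁻¹ dh g⁻¹ = 0` then the form `g⁻¹ dh g⁻¹` is closed. -/
theorem fderiv_dualForm_symm [FiniteDimensional ℝ V] {z h : V → W} {s : Set V} (hs : IsOpen s)
    (hz : ContDiffOn ℝ ∞ z s) (hh : ContDiffOn ℝ ∞ h s) (hne : ∀ y ∈ s, z y ≠ h y) {y : V}
    (hy : y ∈ s) (X Y : V) (hf : FlatRel (fderiv ℝ z y X) (reflG (h y - z y) (fderiv ℝ h y X))
      (fderiv ℝ z y Y) (reflG (h y - z y) (fderiv ℝ h y Y))) :
    fderiv ℝ (dualForm z h) y X Y = fderiv ℝ (dualForm z h) y Y X := by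
  have hnhds := hs.mem_nhds hy
  have h1 : HasFDerivAt (dualForm z h) (fderiv ℝ (dualForm z h) y) y :=
    (((contDiffOn_dualForm hs hz hh hne).contDiffAt hnhds).differentiableAt (by simp)).hasFDerivAt
  have h2 : HasFDerivAt z (fderiv ℝ z y) y :=
    ((hz.contDiffAt hnhds).differentiableAt (by simp)).hasFDerivAt
  have h3 : HasFDerivAt h (fderiv ℝ h y) y :=
    ((hh.contDiffAt hnhds).differentiableAt (by simp)).hasFDerivAt
  have h4 : HasFDerivAt (fderiv ℝ h) (fderiv ℝ (fderiv ℝ h) y) y :=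
    (((((contDiffOn_infty_iff_fderiv_of_isOpen hs).1 hh).2).contDiffAt hnhds).differentiableAt
      (by simp)).hasFDerivAt
  have h5 : fderiv ℝ (fderiv ℝ h) y X Y = fderiv ℝ (fderiv ℝ h) y Y X :=
    ((hh.contDiffAt hnhds).isSymmSndFDerivAt (by simpa using ENat.LEInfty.out)).eq X Y
  have hline : ∀ A : V, HasDerivAt (fun t : ℝ => y + t • A) A 0 := fun A => by
    simpa using ((hasDerivAt_id (0 : ℝ)).smul_const A).const_add y
  have h0 : ∀ A : V, y + (0 : ℝ) • A = y := fun A => by simp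
  -- Differentiating along the line `y + t A` separates the second derivative of `h`, symmetric by
  -- smoothness, from first-order terms, symmetric by flatness.
  have key : ∀ A B : V, fderiv ℝ (dualForm z h) y A B =
      (‖h y - z y‖ ^ 2)⁻¹ • reflG (h y - z y) (fderiv ℝ (fderiv ℝ h) y A B) +
      (- (2 * ⟪h y - z y, fderiv ℝ h y A - fderiv ℝ z y A⟫ / (‖h y - z y‖ ^ 2) ^ 2) • fderiv ℝ h y B
      - (2 * ⟪fderiv ℝ h y A - fderiv ℝ z y A, fderiv ℝ h y B⟫ / (‖h y - z y‖ ^ 2) ^ 2) •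
        (h y - z y)
      + (8 * ⟪h y - z y, fderiv ℝ h y B⟫ * ⟪h y - z y, fderiv ℝ h y A - fderiv ℝ z y A⟫ /
        (‖h y - z y‖ ^ 2) ^ 3) • (h y - z y)
      - (2 * ⟪h y - z y, fderiv ℝ h y B⟫ / (‖h y - z y‖ ^ 2) ^ 2) •
        (fderiv ℝ h y A - fderiv ℝ z y A)) := by
    intro A B
    rw [← h0 A] at h1 h2 h3 h4
    have e1 : HasDerivAt (fun t : ℝ => dualForm z h (y + t • A) B)
        (fderiv ℝ (dualForm z h) y A B) 0 := by
      have := (ContinuousLinearMap.apply ℝ W B).hasFDerivAt.comp_hasDerivAt (0 : ℝ)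
        (h1.comp_hasDerivAt (0 : ℝ) (hline A))
      rwa [h0] at this
    have e2 : HasDerivAt (fun t : ℝ => h (y + t • A) - z (y + t • A))
        (fderiv ℝ h y A - fderiv ℝ z y A) 0 := by
      have := (h3.comp_hasDerivAt (0 : ℝ) (hline A)).sub (h2.comp_hasDerivAt (0 : ℝ) (hline A))
      rwa [h0] at this
    have e3 : HasDerivAt (fun t : ℝ => fderiv ℝ h (y + t • A) B)
        (fderiv ℝ (fderiv ℝ h) y A B) 0 := by
      have := (ContinuousLinearMap.apply ℝ W B).hasFDerivAt.comp_hasDerivAt (0 : ℝ)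
        (h4.comp_hasDerivAt (0 : ℝ) (hline A))
      rwa [h0] at this
    have e4 := hasDerivAt_inv_smul_reflG e2 e3
      (by rw [h0]; exact sub_ne_zero.2 (hne y hy).symm)
    simp only [← dualForm_apply] at e4
    rw [e1.unique e4, h0]
    module
  rw [key, key, h5, symmetric_of_flatRel (sub_ne_zero.2 (hne y hy).symm) hf]

end Closed

section Isothermic

variable (m : ℕ) {n : ℕ} {M : Type*} [TopologicalSpace M] [ChartedSpace (E m) M]

/-- The flatness of a pair of maps into `ℝⁿ` at a point. -/
def FlatAt (z h : M → E n) (p : M) : Prop :=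
  ∀ X Y : E m, FlatRel (dV m z p X) (reflG (h p - z p) (dV m h p X)) (dV m z p Y)
    (reflG (h p - z p) (dV m h p Y))

variable {m}

theorem FlatAt.swap {z h : M → E n} {p : M} (H : FlatAt m z h p) : FlatAt m h z p := fun X Y => by
  have := (H X Y).swap
  rwa [neg_sub] at this

theorem wedge_eq_zero_iff {z fc : M → E n} {p : M} (X Y : E m) :
    wedge (dE m z p) (dE m fc p) X Y = 0 ↔
      FlatRel (dV m z p X) (dV m fc p X) (dV m z p Y) (dV m fc p Y) :=
  cl_mul_sub_eq_zero_iff (dV m z p X) (dV m fc p X) (dV m z p Y) (dV m fc p Y)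

/-- Conjugation by `g⁻¹` differs from the reflection only by the factor `|g|⁻²`, which the relation
ignores. -/
theorem darboux_wedge_eq_zero_iff {z h : M → E n} {p : M} (hne : z p ≠ h p) :
    (∀ X Y : TangentSpace (𝓡 m) p, wedge (dE m z p)
      (fun W => Ring.inverse (cl (h p - z p)) * dE m h p W *
        Ring.inverse (cl (h p - z p))) X Y = 0) ↔ FlatAt m z h p := by
  have hg : h p - z p ≠ 0 := sub_ne_zero.2 hne.symm
  have hN : (‖h p - z p‖ ^ 2)⁻¹ ≠ 0 := by simpa using hg
  refine forall_congr' fun X => forall_congr' fun Y => ?_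
  have h1 : ∀ W : TangentSpace (𝓡 m) p, Ring.inverse (cl (h p - z p)) * dE m h p W *
      Ring.inverse (cl (h p - z p)) =
        cl ((‖h p - z p‖ ^ 2)⁻¹ • reflG (h p - z p) (dV m h p W)) := fun W =>
    inverse_cl_mul_mul hg _
  have h2 : ∀ W : TangentSpace (𝓡 m) p, dE m z p W = cl (dV m z p W) := fun W => rfl
  rw [wedge, h1, h1, h2, h2, cl_mul_sub_eq_zero_iff]
  refine ⟨fun H => ?_, fun H => H.smul _⟩
  have := H.smul (‖h p - z p‖ ^ 2)
  rwa [smul_smul, smul_smul, mul_inv_cancel₀ (by simpa using hN), one_smul, one_smul] at this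

variable [IsManifold (𝓡 m) ∞ M]

/-- Both maps of a Darboux pair of immersions are locally isothermic. -/
theorem isLocallyIsothermicOn_of_flatAt {z h : M → E n} {U : Set M} (hm : 0 < m) (hU : IsOpen U)
    (hz : ContMDiffOn (𝓡 m) 𝓘(ℝ, E n) ∞ z U) (hh : ContMDiffOn (𝓡 m) 𝓘(ℝ, E n) ∞ h U)
    (hne : ∀ p ∈ U, z p ≠ h p) (hzi : ∀ p ∈ U, Function.Injective (dV m z p))
    (hhi : ∀ p ∈ U, Function.Injective (dV m h p)) (hf : ∀ p ∈ U, FlatAt m z h p) :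
    IsLocallyIsothermicOn m U z := by
  intro p hp
  obtain ⟨e, he⟩ : ∃ e, e = chartAt (E m) p := ⟨_, rfl⟩
  have hpe : p ∈ e.source := he ▸ mem_chart_source (E m) p
  have hO : IsOpen (e.target ∩ e.symm ⁻¹' U) := e.symm.isOpen_inter_preimage hU
  have hep : e p ∈ e.target ∩ e.symm ⁻¹' U :=
    ⟨e.map_source hpe, by simpa [e.left_inv hpe] using hp⟩
  obtain ⟨r, hr, hB⟩ := Metric.isOpen_iff.1 hO _ hep
  obtain ⟨B, hBdef⟩ : ∃ B, B = Metric.ball (e p) r := ⟨_, rfl⟩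
  rw [← hBdef] at hB
  have hBo : IsOpen B := hBdef ▸ Metric.isOpen_ball
  have hBc : Convex ℝ B := hBdef ▸ convex_ball _ _
  have hpB : e p ∈ B := hBdef ▸ Metric.mem_ball_self hr
  have hBt : B ⊆ e.target := fun y hy => (hB hy).1
  have hBU : ∀ y ∈ B, e.symm y ∈ U := fun y hy => (hB hy).2
  have hzB : ContDiffOn ℝ ∞ (z ∘ e.symm) B := by
    rw [he] at hB ⊢
    exact (contDiffOn_comp_chart_symm hz p).mono hB
  have hhB : ContDiffOn ℝ ∞ (h ∘ e.symm) B := by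
    rw [he] at hB ⊢
    exact (contDiffOn_comp_chart_symm hh p).mono hB
  have hneB : ∀ y ∈ B, (z ∘ e.symm) y ≠ (h ∘ e.symm) y := fun y hy => hne _ (hBU y hy)
  have hmz : ∀ q ∈ U, MDifferentiableAt (𝓡 m) 𝓘(ℝ, E n) z q := fun q hq =>
    (hz.contMDiffAt (hU.mem_nhds hq)).mdifferentiableAt (by simp)
  have hmh : ∀ q ∈ U, MDifferentiableAt (𝓡 m) 𝓘(ℝ, E n) h q := fun q hq =>
    (hh.contMDiffAt (hU.mem_nhds hq)).mdifferentiableAt (by simp)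
  have hfB : ∀ y ∈ B, ∀ X Y : E m,
      FlatRel (fderiv ℝ (z ∘ e.symm) y X)
        (reflG ((h ∘ e.symm) y - (z ∘ e.symm) y) (fderiv ℝ (h ∘ e.symm) y X))
        (fderiv ℝ (z ∘ e.symm) y Y)
        (reflG ((h ∘ e.symm) y - (z ∘ e.symm) y) (fderiv ℝ (h ∘ e.symm) y Y)) := by
    intro y hy X Y
    have e1 := hasFDerivAt_comp_chart_symm (p := p) (he ▸ hBt hy)
      (hmz _ (by rw [← he]; exact hBU y hy))
    have e2 := hasFDerivAt_comp_chart_symm (p := p) (he ▸ hBt hy)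
      (hmh _ (by rw [← he]; exact hBU y hy))
    rw [← he] at e1 e2
    rw [e1.fderiv, e2.fderiv]
    exact hf _ (hBU y hy) _ _
  have hdual := contDiffOn_dualForm hBo hzB hhB hneB
  -- Poincaré lemma on a coordinate ball; `F` read through the chart is the dual map `f^c`.
  obtain ⟨F, hF⟩ := hBc.exists_forall_hasFDerivAt_of_fderiv_symmetric hBo
    (hdual.differentiableOn (by simp)) fun a ha X Y =>
      fderiv_dualForm_symm hBo hzB hhB hneB ha X Y (hfB a ha X Y)
  have hFs : ContDiffOn ℝ ∞ F B := by
    rw [contDiffOn_infty_iff_fderiv_of_isOpen hBo]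
    exact ⟨fun y hy => (hF y hy).differentiableAt.differentiableWithinAt,
      hdual.congr fun y hy => (hF y hy).fderiv⟩
  have hV : e.symm '' B = e.source ∩ e ⁻¹' B := e.symm_image_eq_source_inter_preimage hBt
  have hVo : IsOpen (e.symm '' B) := hV ▸ e.isOpen_inter_preimage hBo
  have hpV : p ∈ e.symm '' B := ⟨e p, hpB, e.left_inv hpe⟩
  have hVU : e.symm '' B ⊆ U := by
    rintro _ ⟨y, hy, rfl⟩
    exact hBU y hy
  have hdF : ∀ q ∈ e.symm '' B, ∀ X : E m, dV m (fun q => F (e q)) q X =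
      (‖h q - z q‖ ^ 2)⁻¹ • reflG (h q - z q) (dV m h q X) := by
    intro q hq X
    have hqU := hVU hq
    rw [hV] at hq
    have e1 : MDifferentiableAt (𝓡 m) (𝓡 m) e q := by
      rw [he] at hq ⊢
      exact (mdifferentiable_chart p).mdifferentiableAt hq.1
    have e2 := dV_comp e1 (hF _ hq.2)
    have e3 : HasFDerivAt (h ∘ e.symm) (fderiv ℝ (h ∘ e.symm) (e q)) (e q) :=
      ((hhB.contDiffAt (hBo.mem_nhds hq.2)).differentiableAt (by simp)).hasFDerivAt
    have e4 : dV m h q = (fderiv ℝ (h ∘ e.symm) (e q)).comp (dV m e q) := by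
      rw [he] at hq e3 ⊢
      exact dV_eq_comp_chart hq.1 e3
    rw [e2, e4, ContinuousLinearMap.comp_apply, dualForm_apply]
    simp [e.left_inv hq.1]
  refine ⟨e.symm '' B, hVU, hVo,
    ⟨⟨p, hpV⟩, hBc.isPreconnected.image _ (e.symm.continuousOn.mono hBt)⟩, hpV, hz.mono hVU,
    fun q hq => hzi q (hVU hq), fun q => F (e q), ?_, ?_, fun q hq (X Y : E m) => ?_⟩
  · have e1 : ContMDiffOn (𝓡 m) (𝓡 m) ∞ e e.source := he ▸ contMDiffOn_chart
    refine (contMDiffOn_iff_contDiffOn.2 hFs).comp (e1.mono (hV ▸ Set.inter_subset_left)) ?_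
    rw [hV]
    exact fun q hq => hq.2
  -- The dual map is not constant: its derivative is a nonzero multiple of a reflection composed
  -- with the injective `dh`.
  · refine exists_ne_of_injective hm hVo hpV fun X Y hXY => hhi p hp ?_
    rw [hdF p hpV, hdF p hpV, reflG_eq_reflection, reflG_eq_reflection] at hXY
    have h0 : (‖h p - z p‖ ^ 2)⁻¹ ≠ 0 := by
      simpa [sub_eq_zero] using (hne p hp).symm
    exact LinearIsometryEquiv.injective _ (smul_right_injective _ h0 hXY)
  · refine (wedge_eq_zero_iff X Y).2 ?_
    rw [hdF q hq, hdF q hq]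
    exact (hf q (hVU hq) X Y).smul _

end Isothermic

/-! ### Immersions into the sphere in stereographic projection -/

section SphereMaps

variable {m n : ℕ} {M : Type*} [TopologicalSpace M] [ChartedSpace (E m) M]

theorem contMDiffOn_stereographic' {f : M → S n} (hf : ContMDiff (𝓡 m) (𝓡 n) ∞ f) (v : S n) :
    ContMDiffOn (𝓡 m) 𝓘(ℝ, E n) ∞ (fun q => stereographic' n v (f q)) {q | f q ≠ v} := by
  have h1 : ContMDiffOn (𝓡 n) (𝓡 n) ∞ (stereographic' n v) (stereographic' n v).source :=
    contMDiffOn_of_mem_maximalAtlas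
      (IsManifold.subset_maximalAtlas (I := 𝓡 n) (n := ∞) ⟨v, rfl⟩)
  rw [stereographic'_source] at h1
  exact h1.comp hf.contMDiffOn fun q hq => hq

theorem isOpen_ne_value {f : M → S n} (hf : ContMDiff (𝓡 m) (𝓡 n) ∞ f) (v : S n) :
    IsOpen {q | f q ≠ v} := isOpen_ne.preimage hf.continuous

theorem mdifferentiableAt_stereographic' {f : M → S n} (hf : ContMDiff (𝓡 m) (𝓡 n) ∞ f)
    {v : S n} {p : M} (hp : f p ≠ v) :
    MDifferentiableAt (𝓡 m) 𝓘(ℝ, E n) (fun q => stereographic' n v (f q)) p :=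
  ((contMDiffOn_stereographic' hf v).contMDiffAt
    ((isOpen_ne_value hf v).mem_nhds hp)).mdifferentiableAt (by simp)

theorem hasFDerivAt_height (z : E n) :
    HasFDerivAt (height : E n → ℝ) ((1 / 2 : ℝ) • innerSL ℝ z) z := by
  have h := (((hasStrictFDerivAt_norm_sq z).hasFDerivAt).const_mul (1 / 4 : ℝ)).add_const (1 : ℝ)
  refine (h.congr_fderiv ?_).congr_of_eventuallyEq (.of_forall fun w => ?_)
  · ext w
    simp
    ring
  · simp only [height]
    ring

theorem hasFDerivAt_coneFst (v : S n) (z : E n) :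
    HasFDerivAt (coneFst v) ((stereoIncl v).toContinuousLinearMap +
      ((1 / 2 : ℝ) • innerSL ℝ z).smulRight (v : E (n + 1))) z :=
  (stereoIncl v).toContinuousLinearMap.hasFDerivAt.add
    (((hasFDerivAt_height z).sub_const 2).smul_const (v : E (n + 1)))

theorem mdifferentiableAt_coe {f : M → S n} (hf : ContMDiff (𝓡 m) (𝓡 n) ∞ f) (p : M) :
    MDifferentiableAt (𝓡 m) 𝓘(ℝ, E (n + 1)) (fun q => (f q : E (n + 1))) p :=
  ((contMDiff_coe_sphere.comp hf).contMDiffAt).mdifferentiableAt (by simp)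

theorem stereoTangent_dV {f : M → S n} (hf : ContMDiff (𝓡 m) (𝓡 n) ∞ f) {v : S n} {p : M}
    (hp : f p ≠ v) (X : E m) :
    StereoTangent v (f p) (dV m (fun q => stereographic' n v (f q)) p X)
      (dV m (fun q => (f q : E (n + 1))) p X) := by
  have hz := mdifferentiableAt_stereographic' hf hp
  have hx := mdifferentiableAt_coe hf p
  -- Near `p` the map `f` is recovered from its projection, so the quotient rule relates the two
  -- derivatives.
  have h1 : (fun q => (height (stereographic' n v (f q)))⁻¹ • coneFst v (stereographic' n v (f q)))
      =ᶠ[𝓝 p] fun q => (f q : E (n + 1)) := by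
    filter_upwards [(isOpen_ne_value hf v).mem_nhds hp] with q hq
    have h2 := congrArg Prod.fst (coneLift_stereographic' hq)
    simp only [coneLift, lift, Prod.smul_fst] at h2
    rw [h2, smul_smul, inv_mul_cancel₀ (height_pos _).ne', one_smul]
  have h0 := (height_pos (stereographic' n v (f p))).ne'
  have h3 := (hasDerivAt_inv h0).comp_hasFDerivAt _
    (hasFDerivAt_height (stereographic' n v (f p)))
  have h4 := h3.smul (hasFDerivAt_coneFst v (stereographic' n v (f p)))
  have h5 := dV_comp hz h4
  have h6 := (dV_congr h1).symm.trans h5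
  have h7 := congrArg Prod.fst (coneLift_stereographic' hp)
  simp only [coneLift, lift, Prod.smul_fst] at h7
  refine Prod.ext ?_ ?_
  · rw [h6]
    simp [coneDeriv_apply, lift, h7]
    match_scalars <;> field_simp
    ring
  · simp [coneDeriv_apply, lift]

theorem stereoTangent_zero {v x : S n} {ws : E (n + 1)} (h : StereoTangent v x 0 ws) :
    ws = 0 := by
  have h1 := congrArg Prod.fst h
  simp at h1
  exact (smul_eq_zero.1 h1.symm).resolve_left (height_pos _).ne'

theorem injective_dV_coe {f : M → S n} (hf : IsImmersedS m f) (p : M) :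
    Function.Injective (dV m (fun q => (f q : E (n + 1))) p) := by
  have h1 : MDifferentiableAt (𝓡 m) (𝓡 n) f p := hf.1.contMDiffAt.mdifferentiableAt (by simp)
  have h2 : MDifferentiableAt (𝓡 n) 𝓘(ℝ, E (n + 1)) ((↑) : S n → E (n + 1)) (f p) :=
    (contMDiff_coe_sphere (m := ∞)).contMDiffAt.mdifferentiableAt (by simp)
  have h3 := (h2.hasMFDerivAt.comp p h1.hasMFDerivAt).mfderiv
  intro X Y hXY
  have h6 : Function.Injective
      (mfderiv (𝓡 n) 𝓘(ℝ, E (n + 1)) ((↑) : S n → E (n + 1)) (f p)) :=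
    injective_mvfderiv_subtypeVal_sphere (f p)
  refine hf.2 p (h6 ?_)
  have h4 := DFunLike.congr_fun h3 X
  have h5 := DFunLike.congr_fun h3 Y
  exact h4.symm.trans (Eq.trans hXY h5)

theorem injective_dV_stereographic' {f : M → S n} (hf : IsImmersedS m f) {v : S n} {p : M}
    (hp : f p ≠ v) : Function.Injective (dV m (fun q => stereographic' n v (f q)) p) := by
  rw [injective_iff_map_eq_zero]
  intro X hX
  have h1 := stereoTangent_dV hf.1 hp X
  rw [hX] at h1
  exact (injective_iff_map_eq_zero _).1 (injective_dV_coe hf p) X (stereoTangent_zero h1)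

theorem exists_ne_value (hm : 0 < m) {f : M → S n} (hf : IsImmersedS m f) {U : Set M}
    (hU : IsOpen U) (hne : U.Nonempty) (v : S n) : ∃ p ∈ U, f p ≠ v := by
  obtain ⟨p, hp⟩ := hne
  obtain ⟨a, ha, b, hb, hab⟩ := exists_ne_of_injective hm hU hp (injective_dV_coe hf p)
  by_cases h : f a = v
  · exact ⟨b, hb, fun h' => hab (by rw [h, h'])⟩
  · exact ⟨a, ha, h⟩

end SphereMaps

/-! ### Curved flats and Darboux pairs -/

section Pairs

theorem fst_ne_snd {n : ℕ} {M : Type*} (φ : M → Z n) (p : M) : fst φ p ≠ snd φ p := (φ p).2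

variable {m n : ℕ} {M : Type*} [TopologicalSpace M] [ChartedSpace (E m) M] {φ : M → Z n}

theorem mem_tangentImage_iff {p : M} {ξ : Lor n →L[ℝ] Lor n} :
    ξ ∈ tangentImage m φ p ↔ IsTransvection ξ (lift (fst φ p)) (lift (snd φ p)) ∧
      ∃ X : E m, Induces ξ (fst φ p) (dV m (fun q => (fst φ q : E (n + 1))) p X) ∧
        Induces ξ (snd φ p) (dV m (fun q => (snd φ q : E (n + 1))) p X) := by
  refine and_congr ⟨?_, fun h => ?_⟩ Iff.rfl
  · rintro ⟨g, hg, h⟩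
    exact (mem_adP_iff hg ξ).1 h
  · obtain ⟨g, hg⟩ := exists_smul_basePoint (φ p)
    exact ⟨g, hg, (mem_adP_iff hg ξ).2 h⟩

/-- The tangent space at a point is abelian if and only if the Darboux equation holds there in
stereographic projection. -/
theorem abelian_iff_flatAt (hφ : NonDegenerate m φ) {v : S n} {p : M} (hp : p ∈ finiteSet φ v) :
    (∀ ξ ∈ tangentImage m φ p, ∀ η ∈ tangentImage m φ p, ξ * η - η * ξ = 0) ↔
      FlatAt m (fun q => stereographic' n v (fst φ q)) (fun q => stereographic' n v (snd φ q)) p := by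
  have hxy := fst_ne_snd φ p
  have hz := stereographic'_injOn hp.1 hp.2 hxy
  have hf := fun X => stereoTangent_dV (m := m) hφ.1.1 hp.1 X
  have hg := fun X => stereoTangent_dV (m := m) hφ.2.1 hp.2 X
  constructor
  · intro H X Y
    -- Every tangent vector of `M` is realised in the Lie algebra, so the abelian condition tests
    -- all pairs `X, Y`.
    obtain ⟨ξ, h1, h2, h3⟩ := exists_transvection hp.1 hp.2 hxy hz (hf X) (hg X)
    obtain ⟨η, k1, k2, k3⟩ := exists_transvection hp.1 hp.2 hxy hz (hf Y) (hg Y)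
    exact (commute_iff_flatRel hp.1 hp.2 hxy hz (hf X) (hg X) (hf Y) (hg Y) h1 k1 h2 h3 k2 k3).1
      (H ξ (mem_tangentImage_iff.2 ⟨h1, X, h2, h3⟩) η (mem_tangentImage_iff.2 ⟨k1, Y, k2, k3⟩))
  · intro H ξ hξ η hη
    obtain ⟨h1, X, h2, h3⟩ := mem_tangentImage_iff.1 hξ
    obtain ⟨k1, Y, k2, k3⟩ := mem_tangentImage_iff.1 hη
    exact (commute_iff_flatRel hp.1 hp.2 hxy hz (hf X) (hg X) (hf Y) (hg Y) h1 k1 h2 h3 k2 k3).2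
      (H X Y)

theorem isImmersedZ_of_nonDegenerate (hφ : NonDegenerate m φ) : IsImmersedZ m φ := by
  refine ⟨hφ.1.1.prodMk hφ.2.1, fun p X Y h => hφ.1.2 p ?_⟩
  have h1 : MDifferentiableAt (𝓡 m) (𝓡 n) (fst φ) p :=
    hφ.1.1.contMDiffAt.mdifferentiableAt (by simp)
  have h2 : MDifferentiableAt (𝓡 m) (𝓡 n) (snd φ) p :=
    hφ.2.1.contMDiffAt.mdifferentiableAt (by simp)
  have h3 := mfderiv_prodMk h1 h2
  have h4 := (DFunLike.congr_fun h3 X).symm.trans (Eq.trans h (DFunLike.congr_fun h3 Y))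
  exact congrArg Prod.fst h4

theorem isOpen_finiteSet (hφ : NonDegenerate m φ) (v : S n) : IsOpen (finiteSet φ v) :=
  (isOpen_ne_value hφ.1.1 v).inter (isOpen_ne_value hφ.2.1 v)

theorem finiteSet_nonempty [Nonempty M] (hm : 0 < m) (hφ : NonDegenerate m φ) (v : S n) :
    (finiteSet φ v).Nonempty := by
  obtain ⟨p, -, hp⟩ := exists_ne_value hm hφ.1 isOpen_univ Set.univ_nonempty v
  obtain ⟨q, hq, hq'⟩ := exists_ne_value hm hφ.2 (isOpen_ne_value hφ.1.1 v) ⟨p, hp⟩ v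
  exact ⟨q, hq, hq'⟩

theorem isDarbouxPairOn_of_flatAt [Nonempty M] (hm : 0 < m) (hφ : NonDegenerate m φ) {v : S n}
    (H : ∀ p ∈ finiteSet φ v, FlatAt m (fun q => stereographic' n v (fst φ q))
      (fun q => stereographic' n v (snd φ q)) p) :
    IsDarbouxPairOn m (finiteSet φ v) (fun p => stereographic' n v (fst φ p))
      (fun p => stereographic' n v (snd φ p)) := by
  obtain ⟨p, hp⟩ := finiteSet_nonempty hm hφ v
  have hU := isOpen_finiteSet hφ v
  have hne : ∀ p ∈ finiteSet φ v, stereographic' n v (fst φ p) ≠ stereographic' n v (snd φ p) :=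
    fun p hp => stereographic'_injOn hp.1 hp.2 (fst_ne_snd φ p)
  have h1 : ContMDiffOn (𝓡 m) 𝓘(ℝ, E n) ∞ (fun q => stereographic' n v (fst φ q))
      (finiteSet φ v) := (contMDiffOn_stereographic' hφ.1.1 v).mono fun q hq => hq.1
  have h2 : ContMDiffOn (𝓡 m) 𝓘(ℝ, E n) ∞ (fun q => stereographic' n v (snd φ q))
      (finiteSet φ v) := (contMDiffOn_stereographic' hφ.2.1 v).mono fun q hq => hq.2
  have h3 := exists_ne_of_injective hm hU hp (injective_dV_stereographic' hφ.1 hp.1)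
  have h4 := exists_ne_of_injective hm hU hp (injective_dV_stereographic' hφ.2 hp.2)
  refine ⟨h1, h2, h3, h4, hne, fun p hp => ?_⟩
  exact (darboux_wedge_eq_zero_iff (z := fun q => stereographic' n v (fst φ q))
    (h := fun q => stereographic' n v (snd φ q)) (hne p hp)).2 (H p hp)

/-- A non-degenerate pair that satisfies the Darboux equation at one point has dimension at most
two. -/
theorem le_two_of_flatAt (hφ : NonDegenerate m φ) {v : S n} {p : M} (hp : p ∈ finiteSet φ v)
    (H : FlatAt m (fun q => stereographic' n v (fst φ q))
      (fun q => stereographic' n v (snd φ q)) p) : m ≤ 2 := by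
  have h1 := injective_dV_stereographic' hφ.1 hp.1
  have h2 := injective_dV_stereographic' hφ.2 hp.2
  refine le_two_of_flatRel (dV m (fun q => stereographic' n v (fst φ q)) p).toLinearMap
    (((ℝ ∙ (stereographic' n v (snd φ p) - stereographic' n v (fst φ p)))ᗮ.reflection).toLinearEquiv
      ∘ₗ (dV m (fun q => stereographic' n v (snd φ q)) p).toLinearMap) h1
    ?_ fun X Y => ?_
  · rw [LinearMap.coe_comp]
    exact (LinearEquiv.injective _).comp h2
  have := H X Y
  simp only [reflG_eq_reflection] at this
  exact this

/-- The centre `v` is a value `f q` different from `f p`, found where `f` avoids `f̂ p`; an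
immersion of positive dimension is not constant there. -/
theorem exists_mem_finiteSet (hm : 0 < m) (hφ : NonDegenerate m φ) (p : M) :
    ∃ v, p ∈ finiteSet φ v := by
  obtain ⟨q, hq, hq'⟩ := exists_ne_value hm hφ.1 (isOpen_ne_value hφ.1.1 (snd φ p))
    ⟨p, fst_ne_snd φ p⟩ (fst φ p)
  exact ⟨fst φ q, hq'.symm, Ne.symm hq⟩

end Pairs

end PointPairs

end

/-! ### The equivalence of curved flats and Darboux pairs. -/

theorem mainTheorem3 {n m : ℕ} (hm : 2 ≤ m) {M : Type*} [TopologicalSpace M]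
    [ChartedSpace (EuclideanSpace ℝ (Fin m)) M] [IsManifold (𝓡 m) ∞ M] [Nonempty M]
    (φ : M → PointPairs.Z n) (hφ : PointPairs.NonDegenerate m φ) :
    PointPairs.IsCurvedFlat m φ ↔
      PointPairs.IsDarbouxPairOfIsothermicSurfaces m φ := by
  have hm0 : 0 < m := by omega
  constructor
  · rintro ⟨-, H⟩
    have H' : ∀ v, ∀ p ∈ PointPairs.finiteSet φ v, PointPairs.FlatAt m
        (fun q => stereographic' n v (PointPairs.fst φ q))
        (fun q => stereographic' n v (PointPairs.snd φ q)) p :=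
      -- The Lie bracket is by definition the commutator `ξ * η - η * ξ`.
      fun v p hp => (PointPairs.abelian_iff_flatAt hφ hp).1 (H p)
    have hm2 : m = 2 := by
      obtain ⟨p⟩ := ‹Nonempty M›
      obtain ⟨v, hv⟩ := PointPairs.exists_mem_finiteSet hm0 hφ p
      exact le_antisymm (PointPairs.le_two_of_flatAt hφ hv (H' v p hv)) hm
    refine ⟨hm2, fun v => ?_⟩
    have hD := PointPairs.isDarbouxPairOn_of_flatAt hm0 hφ (H' v)
    have hU := PointPairs.isOpen_finiteSet hφ v
    have h1 : ∀ p ∈ PointPairs.finiteSet φ v, Function.Injective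
        (PointPairs.dV m (fun q => stereographic' n v (PointPairs.fst φ q)) p) :=
      fun p hp => PointPairs.injective_dV_stereographic' hφ.1 hp.1
    have h2 : ∀ p ∈ PointPairs.finiteSet φ v, Function.Injective
        (PointPairs.dV m (fun q => stereographic' n v (PointPairs.snd φ q)) p) :=
      fun p hp => PointPairs.injective_dV_stereographic' hφ.2 hp.2
    exact ⟨hD, PointPairs.isLocallyIsothermicOn_of_flatAt hm0 hU hD.1 hD.2.1 hD.2.2.2.2.1 h1 h2
      (H' v), PointPairs.isLocallyIsothermicOn_of_flatAt hm0 hU hD.2.1 hD.1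
      (fun p hp => (hD.2.2.2.2.1 p hp).symm) h2 h1 fun p hp => (H' v p hp).swap⟩
  · rintro ⟨-, H⟩
    refine ⟨PointPairs.isImmersedZ_of_nonDegenerate hφ, fun p => ?_⟩
    -- One centre per point suffices, because the abelian condition does not involve `v`.
    obtain ⟨v, hv⟩ := PointPairs.exists_mem_finiteSet hm0 hφ p
    obtain ⟨-, -, -, -, hne, hD⟩ := (H v).1
    exact (PointPairs.abelian_iff_flatAt hφ hv).2
      ((PointPairs.darboux_wedge_eq_zero_iff (hne p hv)).1 (hD p hv))
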